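/- Let $G$ be a locally compact (Hausdorff) group with left Haar measure $dx$ and modular function $\Delta$. The Haar measure is taken in its inner regular version, so that $L^\infty(G)$ is the dual of $L^1(G)$ (functions are identified when they agree locally almost everywhere); if $G$ is second countable, every left Haar measure is of this kind. Write $\mathcal B=\mathcal B(L^2(G))$, let $\mathcal T(G)$ be its predual, i.e. the space of functionals $T\mapsto\langle T,h\rangle=\sum_i (Tf_i,g_i)$ with $f_i,g_i\in L^2(G)$, $\sum_i\|f_i\|_2^2<\infty$, $\sum_i\|g_i\|_2^2<\infty$, with the norm of the dual of $\mathcal B$, and call the topology of pointwise convergence on $\mathcal T(G)$ the weak-* topology of $\mathcal B$. Let $(\lambda_s f)(t)=f(s^{-1}t)$ and $(\rho_r f)(s)=\Delta(r)^{1/2}f(sr)$ be the left and right regular representations on $L^2(G)$, and let $\mathrm{VN}(G)$ be the weak-* closed linear span of $\{\lambda_s:s\in G\}$. For $a\in L^\infty(G)$ let $M_a\in\mathcal B$ be multiplication by $a$, and let $\mathcal D=\{M_a:a\in L^\infty(G)\}$ be the multiplication masa. For $r\in G$ let $\theta_r:\mathcal T(G)\to\mathcal T(G)$ be given by $\langle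 T,\theta_r(h)\rangle=\langle\rho_rT\rho_r^*,h\rangle$, and for $f\in L^1(G)$ put $\theta(f)(h)=\int_G f(r)\,\theta_r(h)\,dr$. For a left ideal $J$ of the convolution algebra $L^1(G)$, let $J^\perp=\{a\in L^\infty(G):\int_G af\,dx=0\text{ for all }f\in J\}$, let $\mathrm{Ran}\,J$ be the norm closed linear span of $\{\theta(f)(h):f\in J,\ h\in\mathcal T(G)\}$ in $\mathcal T(G)$, and let $(\mathrm{Ran}\,J)^\perp\subseteq\mathcal B$ be its annihilator. Let $\mathrm{Bim}(J^\perp)\subseteq\mathcal B$ be the weak-* closed linear span of $\{AM_aB: A,B\in\mathrm{VN}(G),\ a\in J^\perp\}$. **Proposition.** For every left ideal $J\subseteq L^1(G)$ one has $\mathrm{Bim}(J^\perp)\subseteq(\mathrm{Ran}\,J)^\perp$ and $$\mathrm{Bim}(J^\perp)\cap\mathcal D=(\mathrm{Ran}\,J)^\perp\cap\mathcal D=\{M_a:a\in J^\perp\}.$$ -/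

import Mathlib

open MeasureTheory MeasureTheory.Measure
open scoped ENNReal NNReal

namespace HarmonicBimodule

noncomputable section

section HilbertSpace

variable (H : Type*) [NormedAddCommGroup H] [InnerProductSpace ℂ H]

/-- The predual `T(H)` of `B(H)`, in its isometric realisation as a norm closed subspace of the
Banach dual of `B(H)`: the functionals `T ↦ ∑ i, (T f_i, g_i)` where
`∑ ‖f_i‖² < ∞` and `∑ ‖g_i‖² < ∞`. The inner product of Mathlib is linear in its second variable.
For `H = L²(G)` the functional corresponds to the kernel `h(x, y) = ∑ f_i(x) * conj (g_i(y))`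
under the pairing `⟨T, h⟩`, and the norm of the dual of `B(H)` restricts to the projective
(trace) norm of `h`. -/
def predual : Submodule ℂ ((H →L[ℂ] H) →L[ℂ] ℂ) where
  carrier := {ω | ∃ f g : ℕ → H, Summable (fun i => ‖f i‖ ^ 2) ∧ Summable (fun i => ‖g i‖ ^ 2) ∧
    ∀ T : H →L[ℂ] H, HasSum (fun i => inner ℂ (g i) (T (f i))) (ω T)}
  zero_mem' := ⟨fun _ => 0, fun _ => 0, by simp, by simp, fun T => by simp⟩
  add_mem' := by
    rintro ω ω' ⟨f, g, hf, hg, h⟩ ⟨f', g', hf', hg', h'⟩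
    let e : ℕ ≃ ℕ ⊕ ℕ := Equiv.natSumNatEquivNat.symm
    have key : ∀ u v : ℕ → H, Summable (fun i => ‖u i‖ ^ 2) → Summable (fun i => ‖v i‖ ^ 2) →
        Summable (fun i => ‖Sum.elim u v (e i)‖ ^ 2) := by
      intro u v hu hv
      refine (e.summable_iff (f := fun s => ‖Sum.elim u v s‖ ^ 2)).2 ?_
      exact (HasSum.sum (f := fun s => ‖Sum.elim u v s‖ ^ 2) (by exact hu.hasSum)
        (by exact hv.hasSum)).summable
    refine ⟨fun i => Sum.elim f f' (e i), fun i => Sum.elim g g' (e i), key f f' hf hf',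
      key g g' hg hg', fun T => ?_⟩
    refine (e.hasSum_iff
      (f := fun s => inner ℂ (Sum.elim g g' s) (T (Sum.elim f f' s)))).2 ?_
    exact HasSum.sum (by exact h T) (by exact h' T)
  smul_mem' := by
    rintro c ω ⟨f, g, hf, hg, h⟩
    refine ⟨fun i => c • f i, g, ?_, hg, fun T => ?_⟩
    · simpa [norm_smul, mul_pow] using hf.mul_left (‖c‖ ^ 2)
    · simpa [inner_smul_right] using (h T).mul_left c

/-- The weak-* topology of `B(H)`: the topology of pointwise convergence on the predual. -/
@[reducible] def weakStarTopology : TopologicalSpace (H →L[ℂ] H) :=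
  TopologicalSpace.induced (fun T (ω : predual H) => ω.1 T) Pi.topologicalSpace

variable {H}

/-- The weak-* closed linear span of a set of operators. -/
def weakStarSpan (S : Set (H →L[ℂ] H)) : Set (H →L[ℂ] H) :=
  @closure _ (weakStarTopology H) (Submodule.span ℂ S : Set (H →L[ℂ] H))

variable [CompleteSpace H]

/-- `Ad V : T ↦ V T V*`, as a bounded linear map on `B(H)`. -/
def adOp (V : H →L[ℂ] H) : (H →L[ℂ] H) →L[ℂ] (H →L[ℂ] H) :=
  (ContinuousLinearMap.compL ℂ H H H V).comp
    ((ContinuousLinearMap.compL ℂ H H H).flip (ContinuousLinearMap.adjoint V))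

end HilbertSpace

section Group

variable {G : Type*} [Group G] [TopologicalSpace G] [IsTopologicalGroup G]
  [LocallyCompactSpace G] [MeasurableSpace G] [BorelSpace G]

/-- Left translation `(λ_s f)(t) = f(s⁻¹ t)` on `L^p(G)`; for `p = 2` it is the left regular
representation. -/
def leftReg (p : ℝ≥0∞) [Fact (1 ≤ p)] (μ : Measure G) [IsHaarMeasure μ] (s : G) :
    Lp ℂ p μ →L[ℂ] Lp ℂ p μ :=
  (Lp.compMeasurePreservingₗᵢ ℂ (fun t : G => s⁻¹ * t)
    (measurePreserving_mul_left μ s⁻¹)).toContinuousLinearMap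

/-- The convolution `(g * f)(x) = ∫ g(y) f(y⁻¹ x) dy` of two elements of `L¹(G)`, written as the
Bochner integral `g * f = ∫ g(y) λ_y f dy` in `L¹(G)`. -/
def conv (μ : Measure G) [IsHaarMeasure μ] (g f : Lp ℂ 1 μ) : Lp ℂ 1 μ :=
  ∫ y, g y • leftReg 1 μ y f ∂μ

/-- `J` is a left ideal of the convolution algebra `L¹(G)`. -/
def IsLeftIdeal (μ : Measure G) [IsHaarMeasure μ] (J : Submodule ℂ (Lp ℂ 1 μ)) : Prop :=
  ∀ g : Lp ℂ 1 μ, ∀ f ∈ J, conv μ g f ∈ J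

/-- The annihilator of `J ⊆ L¹(G)` in `L^∞(G)`. -/
def annihilator (μ : Measure G) (J : Submodule ℂ (Lp ℂ 1 μ)) : Set (Lp ℂ ∞ μ) :=
  {a | ∀ f ∈ J, ∫ x, a x * f x ∂μ = 0}

/-- The operator `M_a` of multiplication by `a ∈ L^∞(G)` on `L²(G)`. -/
def mulOp (μ : Measure G) (a : Lp ℂ ∞ μ) : Lp ℂ 2 μ →L[ℂ] Lp ℂ 2 μ :=
  (ContinuousLinearMap.mul ℂ ℂ).holderL μ ∞ 2 2 a

/-- The multiplication masa `D = {M_a : a ∈ L^∞(G)}`. -/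
def multMasa (μ : Measure G) : Set (Lp ℂ 2 μ →L[ℂ] Lp ℂ 2 μ) :=
  Set.range (mulOp μ)

/-- The group von Neumann algebra: the weak-* closed linear span of the left translations. -/
def groupVN (μ : Measure G) [IsHaarMeasure μ] : Set (Lp ℂ 2 μ →L[ℂ] Lp ℂ 2 μ) :=
  weakStarSpan (Set.range (leftReg 2 μ))

/-- `Bim(U)`: the weak-* closed linear span of the operators `A M_a B` with `A, B ∈ VN(G)`
and `a ∈ U`. -/
def bim (μ : Measure G) [IsHaarMeasure μ] (U : Set (Lp ℂ ∞ μ)) :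
    Set (Lp ℂ 2 μ →L[ℂ] Lp ℂ 2 μ) :=
  weakStarSpan {T | ∃ A ∈ groupVN μ, ∃ B ∈ groupVN μ, ∃ a ∈ U, T = A * mulOp μ a * B}

/-- The modular function `Δ`, with the convention `μ(E r) = Δ(r) μ(E)` for left Haar
measure `μ`. Mathlib's character is the inverse of it. -/
def modularFn (r : G) : ℝ≥0 := (modularCharacterFun r)⁻¹

theorem memLp_rightTranslate {μ : Measure G} [IsHaarMeasure μ] [InnerRegular μ] (r : G)
    (f : Lp ℂ 2 μ) : MemLp (fun s => f (s * r)) 2 μ := by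
  have h : MemLp f 2 (map (· * r) μ) := by
    rw [map_right_mul_eq_modularCharacterFun_smul]
    exact (Lp.memLp f).smul_measure ENNReal.coe_ne_top
  exact h.comp_of_map (measurable_mul_const r).aemeasurable

theorem eLpNorm_rightTranslate {μ : Measure G} [IsHaarMeasure μ] [InnerRegular μ] (r : G)
    (f : Lp ℂ 2 μ) : eLpNorm (fun s => f (s * r)) 2 μ
      = (modularCharacterFun r : ℝ≥0∞) ^ (1 / 2 : ℝ) * eLpNorm f 2 μ := by
  have h := eLpNorm_map_measure (μ := μ) (p := 2) (g := f) (f := fun s => s * r)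
    (by
      rw [map_right_mul_eq_modularCharacterFun_smul]
      exact (Lp.memLp f).1.smul_measure _)
    (measurable_mul_const r).aemeasurable
  rw [map_right_mul_eq_modularCharacterFun_smul] at h
  have h2 : eLpNorm f 2 (modularCharacterFun r • μ)
      = (modularCharacterFun r : ℝ≥0∞) ^ (1 / 2 : ℝ) * eLpNorm f 2 μ := by
    have := eLpNorm_smul_measure_of_ne_top (p := 2) (by simp) (f := f) (μ := μ)
      (modularCharacterFun r : ℝ≥0∞)
    simpa using this
  rw [← h2, h]
  rfl

theorem ae_rightTranslate {μ : Measure G} [IsHaarMeasure μ] [InnerRegular μ] (r : G)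
    {P : G → Prop} (h : ∀ᵐ s ∂μ, P s) : ∀ᵐ s ∂μ, P (s * r) := by
  refine ae_of_ae_map (f := fun s => s * r) (measurable_mul_const r).aemeasurable ?_
  rw [map_right_mul_eq_modularCharacterFun_smul]
  exact Measure.ae_smul_measure h _

/-- The right regular representation `(ρ_r f)(s) = Δ(r)^{1/2} f(s r)` on `L²(G)`. -/
def rightReg (μ : Measure G) [IsHaarMeasure μ] [InnerRegular μ] (r : G) :
    Lp ℂ 2 μ →ₗᵢ[ℂ] Lp ℂ 2 μ where
  toFun f := ((Real.sqrt (modularFn r) : ℝ) : ℂ) • (memLp_rightTranslate r f).toLp _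
  map_add' f g := by
    rw [← smul_add, ← MemLp.toLp_add]
    congr 1
    apply MemLp.toLp_congr
    filter_upwards [ae_rightTranslate r (Lp.coeFn_add f g)] with s hs using hs
  map_smul' c f := by
    rw [RingHom.id_apply, smul_comm c]
    congr 1
    refine Eq.trans (MemLp.toLp_congr _ ((memLp_rightTranslate r f).const_smul c) ?_)
      (MemLp.toLp_const_smul c _)
    filter_upwards [ae_rightTranslate r (Lp.coeFn_smul c f)] with s hs using hs
  norm_map' f := by
    have hpos : (0 : ℝ) < modularCharacterFun r := by
      exact_mod_cast modularCharacterFun_pos r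
    simp only [LinearMap.coe_mk, AddHom.coe_mk]
    rw [norm_smul, Lp.norm_toLp, eLpNorm_rightTranslate, ENNReal.toReal_mul,
      ← ENNReal.toReal_rpow, ENNReal.coe_toReal, ← Real.sqrt_eq_rpow, ← Lp.norm_def,
      Complex.norm_real, Real.norm_of_nonneg (Real.sqrt_nonneg _), ← mul_assoc,
      ← Real.sqrt_mul (by positivity)]
    simp [modularFn, hpos.ne']

/-- The map `θ_r` on the predual with adjoint `Ad ρ_r`, on all of the dual of `B(L²(G))`. -/
def thetaPt (μ : Measure G) [IsHaarMeasure μ] [InnerRegular μ] (r : G)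
    (ω : (Lp ℂ 2 μ →L[ℂ] Lp ℂ 2 μ) →L[ℂ] ℂ) : (Lp ℂ 2 μ →L[ℂ] Lp ℂ 2 μ) →L[ℂ] ℂ :=
  ω.comp (adOp (rightReg μ r).toContinuousLinearMap)

/-- `θ(f)(ω) = ∫ f(r) θ_r(ω) dr`, a Bochner integral. -/
def theta (μ : Measure G) [IsHaarMeasure μ] [InnerRegular μ] (f : Lp ℂ 1 μ)
    (ω : (Lp ℂ 2 μ →L[ℂ] Lp ℂ 2 μ) →L[ℂ] ℂ) : (Lp ℂ 2 μ →L[ℂ] Lp ℂ 2 μ) →L[ℂ] ℂ :=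
  ∫ r, f r • thetaPt μ r ω ∂μ

/-- `Ran J`: the norm closed linear span of the `θ(f)(h)` with `f ∈ J` and `h ∈ T(G)`. -/
def ran (μ : Measure G) [IsHaarMeasure μ] [InnerRegular μ] (J : Submodule ℂ (Lp ℂ 1 μ)) :
    Submodule ℂ ((Lp ℂ 2 μ →L[ℂ] Lp ℂ 2 μ) →L[ℂ] ℂ) :=
  (Submodule.span ℂ {φ | ∃ f ∈ J, ∃ h ∈ predual (Lp ℂ 2 μ), φ = theta μ f h}).topologicalClosure

/-- The annihilator `(Ran J)^⊥` in `B(L²(G))`. -/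
def ranPerp (μ : Measure G) [IsHaarMeasure μ] [InnerRegular μ] (J : Submodule ℂ (Lp ℂ 1 μ)) :
    Set (Lp ℂ 2 μ →L[ℂ] Lp ℂ 2 μ) :=
  {T | ∀ φ ∈ ran μ J, φ T = 0}

end Group

end

end HarmonicBimodule

/-! The core is one identity, `theta_vecFun_mulOp`: for vectors `u`, `v` in `C_c(G)` and `k = u *
star v`, the functional `θ(f)` of the vector functional of `u, v`, evaluated at `M_a`, equals `⟨a, k
* f⟩`. On the diagonal, pairing with `Ran J` is therefore convolution from the left.

If `f ∈ J` and `a ∈ J^⊥`, then `k * f ∈ J` and the pairing is zero; density and norm continuity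
carry this to the whole predual (`theta_mulOp_eq_zero`). Since `ρ` commutes with `λ`, the
annihilator of `Ran J` absorbs left translations on both sides. As `θ(f)` preserves the predual
(`theta_mem_predual`), it is weak-* closed, so it absorbs `VN(G)` and contains `Bim(J^⊥)`
(`bim_subset_ranPerp`).

Conversely, if `M_a` annihilates `Ran J`, the continuous function `y ↦ ⟨a, λ_y f⟩` integrates to
zero against every `|φ|²` with `φ` in `C_c(G)`, so it vanishes at the identity, which says `⟨a, f⟩ =
0` (`mem_annihilator_of_mulOp_mem_ranPerp`).

Neither σ-compactness nor second countability is assumed. Strong measurability, Fubini and the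
tensor decomposition of vector valued `L²` are thus obtained from `C_c` density, compact supports
and Hilbert bases of arbitrary cardinality. -/

namespace HarmonicBimodule

open scoped Topology BoundedContinuousFunction

set_option linter.unusedSectionVars false

/-! ### Density of `C_c` in `L^p` and vector valued integration against `L¹` densities. -/

section Density

variable {X : Type*} [TopologicalSpace X] [T2Space X] [LocallyCompactSpace X] [MeasurableSpace X]
  [BorelSpace X] {μ : Measure X} [IsLocallyFiniteMeasure μ] [InnerRegularCompactLTTop μ]
  {p : ℝ≥0∞}

/-- Compactly supported continuous functions approximate a multiple of the indicator of a set of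
finite measure in `L^p`, for a measure which is inner regular on sets of finite measure. -/
theorem exists_hasCompactSupport_eLpNorm_sub_indicator_le (hp : p ≠ ∞) (c : ℂ) {t : Set X}
    (ht : MeasurableSet t) (htμ : μ t < ∞) {ε : ℝ≥0∞} (hε : ε ≠ 0) :
    ∃ g : X → ℂ, eLpNorm (g - t.indicator fun _ => c) p μ ≤ ε ∧
      Continuous g ∧ HasCompactSupport g := by
  rcases exists_Lp_half ℂ μ p hε with ⟨δ, δpos, hδ⟩
  obtain ⟨η, ηpos, hη⟩ := exists_eLpNorm_indicator_le (μ := μ) hp c δpos.ne'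
  have hη0 : (η : ℝ≥0∞) ≠ 0 := by exact_mod_cast ηpos.ne'
  obtain ⟨s, st, s_compact, s_closed, μs⟩ := ht.exists_isCompact_isClosed_sdiff_lt htμ.ne hη0
  have hsμ : μ s < ∞ := (measure_mono st).trans_lt htμ
  -- Outer approximation may fail for `t`, but holds for the compact set `s`.
  obtain ⟨U, sU, U_open, hU⟩ := s_compact.exists_isOpen_lt_of_lt (μ := μ) (μ s + η)
    (ENNReal.lt_add_right hsμ.ne hη0)
  have hUs : μ (U \ s) ≤ η := by
    rw [measure_sdiff sU s_closed.measurableSet.nullMeasurableSet hsμ.ne]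
    exact tsub_le_iff_left.2 hU.le
  obtain ⟨f, hf1, hf0, hfc, hf01⟩ := exists_continuous_one_zero_of_isCompact s_compact
    U_open.isClosed_compl (Set.disjoint_compl_right_iff_subset.2 sU)
  have fcont : Continuous fun x => (f x : ℂ) * c := by fun_prop
  have I1 : eLpNorm ((s.indicator fun _ => c) - t.indicator fun _ => c) p μ ≤ δ := by
    rw [← eLpNorm_neg, neg_sub, ← Set.indicator_sdiff st]
    exact hη _ μs.le
  have I2 : eLpNorm ((fun x => (f x : ℂ) * c) - s.indicator fun _ => c) p μ ≤ δ := by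
    refine (eLpNorm_mono fun x => ?_).trans (hη _ hUs)
    by_cases hs : x ∈ s
    · simp [hs, hf1 hs]
    by_cases hxU : x ∈ U
    · simp only [Pi.sub_apply, hs, not_false_eq_true, Set.indicator_of_notMem, sub_zero,
        Set.indicator_of_mem (show x ∈ U \ s from ⟨hxU, hs⟩), norm_mul, Complex.norm_real,
        Real.norm_of_nonneg (hf01 x).1]
      exact mul_le_of_le_one_left (norm_nonneg _) (hf01 x).2
    · simp [hs, hf0 hxU]
  have fsupp : HasCompactSupport fun x => (f x : ℂ) * c :=
    hfc.comp_left (g := fun y : ℝ => (y : ℂ) * c) (by simp)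
  have aesm : AEStronglyMeasurable (fun x => (f x : ℂ) * c) μ :=
    (fcont.stronglyMeasurable_of_hasCompactSupport fsupp).aestronglyMeasurable
  refine ⟨_, ?_, fcont, fsupp⟩
  · have := hδ _ _ (aesm.sub
      (aestronglyMeasurable_const.indicator s_closed.measurableSet))
      ((aestronglyMeasurable_const.indicator s_closed.measurableSet).sub
        (aestronglyMeasurable_const.indicator ht)) I2 I1
    simpa using this.le

variable (μ p) in
/-- The elements of `L^p` represented by a continuous function with compact support. -/
def compactlySupportedLp : Set (Lp ℂ p μ) :=
  {h | ∃ φ : X → ℂ, Continuous φ ∧ HasCompactSupport φ ∧ h =ᵐ[μ] φ}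

variable (μ) in
theorem dense_compactlySupportedLp [Fact (1 ≤ p)] (hp : p ≠ ∞) :
    Dense (compactlySupportedLp μ p) := by
  intro f
  refine (mem_closure_iff_nhds_basis Metric.nhds_basis_closedEBall).2 fun ε hε ↦ ?_
  obtain ⟨g, hg, gc, gs⟩ := (Lp.memLp f).induction_dense hp
    (fun g : X → ℂ => Continuous g ∧ HasCompactSupport g)
    (fun c s hs hsμ ε hε => exists_hasCompactSupport_eLpNorm_sub_indicator_le hp c hs hsμ hε)
    (fun f g hf hg => ⟨hf.1.add hg.1, hf.2.add hg.2⟩)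
    (fun f hf => (hf.1.stronglyMeasurable_of_hasCompactSupport hf.2).aestronglyMeasurable) hε.ne'
  have gm : MemLp g p μ := gc.memLp_of_hasCompactSupport gs
  refine ⟨gm.toLp _, ⟨g, gc, gs, gm.coeFn_toLp⟩, ?_⟩
  rwa [Metric.mem_closedEBall', ← Lp.toLp_coeFn f (Lp.memLp f), Lp.edist_toLp_toLp]

/-- A family of vectors with a continuous dependence on the point becomes strongly measurable after
multiplication by an integrable function, even if the space is not second countable. -/
theorem aestronglyMeasurable_smul_of_continuous {E : Type*} [NormedAddCommGroup E]
    [NormedSpace ℂ E] (f : Lp ℂ 1 μ) {Φ : X → E} (hΦ : Continuous Φ) :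
    AEStronglyMeasurable (fun x => f x • Φ x) μ := by
  obtain ⟨u, hu, hlim⟩ := mem_closure_iff_seq_limit.1
    (dense_compactlySupportedLp μ (p := 1) ENNReal.one_ne_top f)
  obtain ⟨ns, -, hns⟩ := (tendstoInMeasure_of_tendsto_Lp hlim).exists_seq_tendsto_ae
  refine aestronglyMeasurable_of_tendsto_ae Filter.atTop (f := fun n x => u (ns n) x • Φ x)
    (fun n => ?_) ?_
  · obtain ⟨φ, hφ, hc, he⟩ := hu (ns n)
    -- Compact support gives a compact, hence separable, range.
    refine AEStronglyMeasurable.congr (f := fun x => φ x • Φ x)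
      ((hφ.smul hΦ).stronglyMeasurable_of_hasCompactSupport hc.smul_right).aestronglyMeasurable ?_
    filter_upwards [he] with x hx using by rw [hx]
  · filter_upwards [hns] with x hx using hx.smul_const _

theorem integrable_smul_bcf {E : Type*} [NormedAddCommGroup E]
    [NormedSpace ℂ E] (f : Lp ℂ 1 μ) (Φ : X →ᵇ E) : Integrable (fun x => f x • Φ x) μ :=
  ((L1.integrable_coeFn f).norm.mul_const ‖Φ‖).mono'
    (aestronglyMeasurable_smul_of_continuous f Φ.continuous)
    (.of_forall fun x => by
      rw [norm_smul]; exact mul_le_mul_of_nonneg_left (Φ.norm_coe_le_norm x) (norm_nonneg _))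

variable (μ) in
/-- The integral of a bounded continuous vector valued function against an integrable density. -/
noncomputable def integralPairing (E : Type*) [NormedAddCommGroup E] [NormedSpace ℂ E]
    [CompleteSpace E] : Lp ℂ 1 μ →L[ℂ] (X →ᵇ E) →L[ℂ] E :=
  LinearMap.mkContinuous₂
    (LinearMap.mk₂ ℂ (fun f Φ => ∫ x, f x • Φ x ∂μ)
      (fun f g Φ => by
        rw [← integral_add (integrable_smul_bcf f Φ) (integrable_smul_bcf g Φ)]
        refine integral_congr_ae ?_
        filter_upwards [Lp.coeFn_add f g] with x hx
        rw [hx, Pi.add_apply, add_smul])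
      (fun c f Φ => by
        rw [← integral_smul]
        refine integral_congr_ae ?_
        filter_upwards [Lp.coeFn_smul c f] with x hx
        rw [hx, Pi.smul_apply, smul_assoc])
      (fun f Φ Ψ => by
        rw [← integral_add (integrable_smul_bcf f Φ) (integrable_smul_bcf f Ψ)]
        simp)
      (fun c f Φ => by
        rw [← integral_smul]
        simp [smul_comm c])) 1
    (fun f Φ => by
      rw [one_mul, LinearMap.mk₂_apply, L1.norm_eq_integral_norm, ← integral_mul_const]
      refine norm_integral_le_of_norm_le ((L1.integrable_coeFn f).norm.mul_const _)
        (.of_forall fun x => ?_)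
      rw [norm_smul]; exact mul_le_mul_of_nonneg_left (Φ.norm_coe_le_norm x) (norm_nonneg _))

end Density

/-! ### Vector functionals, the predual and its weak-* continuity. -/

section Predual

variable {H : Type*} [NormedAddCommGroup H] [InnerProductSpace ℂ H]

/-- The vector functional `T ↦ (T u, v)`. -/
noncomputable def vecFun (u v : H) : (H →L[ℂ] H) →L[ℂ] ℂ :=
  (innerSL ℂ v).comp (ContinuousLinearMap.apply ℂ H u)

@[simp]
theorem vecFun_apply (u v : H) (T : H →L[ℂ] H) : vecFun u v T = inner ℂ v (T u) := rfl

theorem norm_vecFun_le (u v : H) : ‖vecFun u v‖ ≤ ‖u‖ * ‖v‖ := by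
  refine ContinuousLinearMap.opNorm_le_bound _ (by positivity) fun T => ?_
  calc ‖inner ℂ v (T u)‖ ≤ ‖v‖ * ‖T u‖ := norm_inner_le_norm _ _
    _ ≤ ‖v‖ * (‖T‖ * ‖u‖) := by gcongr; exact T.le_opNorm u
    _ = _ := by ring

theorem continuous_vecFun {Y : Type*} [TopologicalSpace Y] {u v : Y → H} (hu : Continuous u)
    (hv : Continuous v) : Continuous fun y => vecFun (u y) (v y) := by
  unfold vecFun; fun_prop

/-- Families indexed by an arbitrary type represent elements of the predual. -/
theorem mem_predual_of_hasSum {ι : Type*} {ω : (H →L[ℂ] H) →L[ℂ] ℂ} (f g : ι → H)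
    (hf : Summable fun i => ‖f i‖ ^ 2) (hg : Summable fun i => ‖g i‖ ^ 2)
    (h : ∀ T : H →L[ℂ] H, HasSum (fun i => inner ℂ (g i) (T (f i))) (ω T)) :
    ω ∈ predual H := by
  -- Square summability leaves countably many nonzero `f i`, and the other terms vanish whatever `g
  -- i` is. The support may be finite, hence an injection into `ℕ` and extension by zero.
  let s : Set ι := Function.support fun i => ‖f i‖ ^ 2
  have hs : Countable s := hf.countable_support
  obtain ⟨e, he⟩ := exists_injective_nat s
  have hsum : ∀ u : ι → H, Summable (fun i => ‖u i‖ ^ 2) →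
      Summable fun n => ‖Function.extend e (fun i : s => u i) 0 n‖ ^ 2 := by
    intro u hu
    have h1 : (fun n => ‖Function.extend e (fun i : s => u i) 0 n‖ ^ 2)
        = Function.extend e (fun i : s => ‖u i‖ ^ 2) 0 := by
      funext n
      by_cases hn : ∃ i, e i = n
      · obtain ⟨i, rfl⟩ := hn
        simp [he.extend_apply]
      · simp [Function.extend_apply' _ _ _ hn]
    rw [h1]
    refine (Function.Injective.summable_iff he
      (fun x hx => Function.extend_apply' _ _ x fun ⟨i, hi⟩ => hx ⟨i, hi⟩)).1 ?_
    rw [Function.extend_comp he]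
    exact hu.subtype s
  refine ⟨_, _, hsum f hf, hsum g hg, fun T => ?_⟩
  have h1 : HasSum (fun i : s => inner ℂ (g i) (T (f i))) (ω T) := by
    refine (hasSum_subtype_iff_of_support_subset fun i hi => ?_).2 (h T)
    contrapose! hi
    have : f i = 0 := by simpa [s] using hi
    simp [this]
  convert! (Function.Injective.hasSum_iff he
    (f := Function.extend e (fun i : s => inner ℂ (g i) (T (f i))) 0)
    (fun x hx => Function.extend_apply' _ _ _ (by simpa using hx))).1 ?_ with n
  · by_cases hn : ∃ i, e i = n
    · obtain ⟨i, rfl⟩ := hn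
      simp [he.extend_apply]
    · simp [Function.extend_apply' _ _ _ hn]
  · simpa [Function.extend_comp he] using h1

theorem norm_vecFun_le_add (u v : H) : ‖vecFun u v‖ ≤ ‖u‖ ^ 2 + ‖v‖ ^ 2 := by
  refine (norm_vecFun_le u v).trans ?_
  nlinarith [sq_nonneg (‖u‖ - ‖v‖), sq_nonneg (‖u‖), sq_nonneg ‖v‖]

theorem vecFun_mem_predual (u v : H) : vecFun u v ∈ predual H :=
  mem_predual_of_hasSum (ι := Unit) (fun _ => u) (fun _ => v) (.of_finite) (.of_finite)
    fun T => by simp [vecFun]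

theorem norm_inner_clm_le (T : H →L[ℂ] H) (u v : H) :
    ‖inner ℂ v (T u)‖ ≤ ‖T‖ * (‖u‖ ^ 2 + ‖v‖ ^ 2) := by
  have h1 : ‖inner ℂ v (T u)‖ ≤ ‖v‖ * (‖T‖ * ‖u‖) :=
    (norm_inner_le_norm _ _).trans (by gcongr; exact T.le_opNorm u)
  have h2 : ‖u‖ * ‖v‖ ≤ ‖u‖ ^ 2 + ‖v‖ ^ 2 := by
    nlinarith [sq_nonneg (‖u‖ - ‖v‖), sq_nonneg (‖u‖), sq_nonneg ‖v‖]
  nlinarith [mul_le_mul_of_nonneg_left h2 (norm_nonneg T)]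

theorem summable_clm_of_norm_le {A ι : Type*} [NormedAddCommGroup A] [NormedSpace ℂ A]
    {φ : ι → A →L[ℂ] ℂ} {b : ι → ℝ} (hb : ∀ i, ‖φ i‖ ≤ b i) (h : Summable b) : Summable φ :=
  Summable.of_norm_bounded h hb

/-- The series representing an element of the predual converges in norm. -/
theorem exists_hasSum_vecFun {ω : (H →L[ℂ] H) →L[ℂ] ℂ} (hω : ω ∈ predual H) :
    ∃ f g : ℕ → H, Summable (fun i => ‖f i‖ ^ 2) ∧ Summable (fun i => ‖g i‖ ^ 2) ∧
      HasSum (fun i => vecFun (f i) (g i)) ω := by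
  obtain ⟨f, g, hf, hg, h⟩ := hω
  refine ⟨f, g, hf, hg, ?_⟩
  have hs : Summable fun i => vecFun (f i) (g i) :=
    summable_clm_of_norm_le (fun i => norm_vecFun_le_add (f i) (g i)) (hf.add hg)
  obtain ⟨φ, hφ⟩ := hs
  have hωφ : ω = φ := by
    ext T
    have h1 := hφ.mapL (ContinuousLinearMap.apply ℂ ℂ T)
    simp only [ContinuousLinearMap.apply_apply, vecFun_apply] at h1
    exact (h T).unique h1
  rwa [hωφ]

/-- The predual is closed under two-sided multiplication by operators. -/
theorem exists_mem_predual_mul_mul [CompleteSpace H] {ω : (H →L[ℂ] H) →L[ℂ] ℂ}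
    (hω : ω ∈ predual H) (A B : H →L[ℂ] H) :
    ∃ ω' ∈ predual H, ∀ T, ω' T = ω (A * T * B) := by
  obtain ⟨f, g, hf, hg, h⟩ := hω
  refine ⟨ω.comp ((ContinuousLinearMap.compL ℂ H H H A).comp
    ((ContinuousLinearMap.compL ℂ H H H).flip B)), ?_, fun T => rfl⟩
  have hs : ∀ (C : H →L[ℂ] H) (u : ℕ → H), Summable (fun i => ‖u i‖ ^ 2) →
      Summable fun i => ‖C (u i)‖ ^ 2 := fun C u hu => by
    refine Summable.of_nonneg_of_le (fun i => by positivity) (fun i => ?_)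
      (hu.mul_left (‖C‖ ^ 2))
    rw [← mul_pow]
    gcongr
    exact C.le_opNorm _
  refine ⟨fun i => B (f i), fun i => ContinuousLinearMap.adjoint A (g i), hs _ _ hf, hs _ _ hg,
    fun T => ?_⟩
  have h1 := h (A * T * B)
  simp only [ContinuousLinearMap.adjoint_inner_left]
  exact h1

/-- A functional in the predual which vanishes on a set vanishes on its weak-* closed span. -/
theorem eq_zero_of_mem_weakStarSpan {ω : (H →L[ℂ] H) →L[ℂ] ℂ} (hω : ω ∈ predual H)
    {S : Set (H →L[ℂ] H)} (hS : ∀ T ∈ S, ω T = 0) {T : H →L[ℂ] H} (hT : T ∈ weakStarSpan S) :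
    ω T = 0 := by
  have hc : @Continuous _ _ (weakStarTopology H) _ (fun T : H →L[ℂ] H => ω T) :=
    @Continuous.comp _ _ _ (weakStarTopology H) _ _ (fun T (ω : predual H) => ω.1 T) _
      (continuous_apply (⟨ω, hω⟩ : predual H)) continuous_induced_dom
  have hcl : @IsClosed _ (weakStarTopology H) {T : H →L[ℂ] H | ω T = 0} :=
    @IsClosed.preimage _ _ (weakStarTopology H) _ _ hc _ isClosed_singleton
  refine @closure_minimal _ (weakStarTopology H) _ _ ?_ hcl T hT
  intro T hT
  induction hT using Submodule.span_induction with
  | mem x hx => exact hS x hx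
  | zero => simp
  | add x y _ _ hx hy => simp_all
  | smul c x _ hx => simp_all

theorem subset_weakStarSpan (S : Set (H →L[ℂ] H)) : S ⊆ weakStarSpan S :=
  Submodule.subset_span.trans (@subset_closure _ (weakStarTopology H) _)

end Predual

/-! ### Vector valued `L²` as a Hilbert sum of copies of `H`. -/

section Amplification

variable {X : Type*} [MeasurableSpace X] (μ : Measure X)
  {H : Type*} [NormedAddCommGroup H] [InnerProductSpace ℂ H]

/-- The elementary tensor `b ⊗ x` in `L²(X; H)`. -/
noncomputable def tensorLp (b : Lp ℂ 2 μ) (x : H) : Lp H 2 μ :=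
  (ContinuousLinearMap.toSpanSingleton ℂ x).compLp b

variable {μ}

theorem coeFn_tensorLp (b : Lp ℂ 2 μ) (x : H) : tensorLp μ b x =ᵐ[μ] fun r => b r • x :=
  ContinuousLinearMap.coeFn_compLp _ b

theorem inner_tensorLp (b b' : Lp ℂ 2 μ) (x y : H) :
    inner ℂ (tensorLp μ b x) (tensorLp μ b' y) = inner ℂ b b' * inner ℂ x y := by
  rw [L2.inner_def, L2.inner_def, ← integral_mul_const]
  refine integral_congr_ae ?_
  filter_upwards [coeFn_tensorLp b x, coeFn_tensorLp b' y] with r h1 h2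
  rw [h1, h2, inner_smul_left, inner_smul_right, RCLike.inner_apply]
  ring

theorem norm_tensorLp (b : Lp ℂ 2 μ) (x : H) : ‖tensorLp μ b x‖ = ‖b‖ * ‖x‖ := by
  rw [← sq_eq_sq₀ (norm_nonneg _) (by positivity), mul_pow]
  have h := inner_tensorLp b b x x
  simp only [inner_self_eq_norm_sq_to_K] at h
  exact_mod_cast h

/-- The map `x ↦ b ⊗ x` from `H` to `L²(X; H)`, for a unit vector `b` of `L²(X)`. -/
noncomputable def tensorIsometry (b : Lp ℂ 2 μ) (hb : ‖b‖ = 1) : H →ₗᵢ[ℂ] Lp H 2 μ where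
  toFun x := tensorLp μ b x
  map_add' x y := by
    simp [tensorLp, ContinuousLinearMap.toSpanSingleton_add, ContinuousLinearMap.add_compLp]
  map_smul' c x := by
    simp [tensorLp, ContinuousLinearMap.toSpanSingleton_smul, ContinuousLinearMap.smul_compLp]
  norm_map' x := (norm_tensorLp b x).trans (by rw [hb, one_mul])

/-- For fixed `x`, the map `b ↦ b ⊗ x` is continuous and linear. -/
noncomputable def tensorRight (x : H) : Lp ℂ 2 μ →L[ℂ] Lp H 2 μ :=
  (ContinuousLinearMap.toSpanSingleton ℂ x).compLpL 2 μ

variable [CompleteSpace H]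

/-- A Hilbert basis of `L²(X)` decomposes `L²(X; H)` as a Hilbert sum of copies of `H`. -/
theorem isHilbertSum_tensorIsometry {ι : Type*} (b : HilbertBasis ι ℂ (Lp ℂ 2 μ)) :
    IsHilbertSum ℂ (fun _ : ι => H)
      fun i => tensorIsometry (b i) (b.orthonormal.norm_eq_one i) := by
  refine IsHilbertSum.mk (fun i j hij x y => ?_) ?_
  · change inner ℂ (tensorLp μ (b i) x) (tensorLp μ (b j) y) = 0
    rw [inner_tensorLp, b.orthonormal.inner_eq_zero hij, zero_mul]
  · intro F _
    set W := (⨆ i, LinearMap.range (tensorIsometry (H := H) (b i)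
      (b.orthonormal.norm_eq_one i)).toLinearMap).topologicalClosure with hW
    -- For fixed `x`, the `a` with `a ⊗ x ∈ W` form a closed subspace containing the basis. Taking
    -- indicators for `a` then yields all simple functions.
    have hbx : ∀ (a : Lp ℂ 2 μ) (x : H), tensorLp μ a x ∈ W := fun a x => by
      have h1 : (Submodule.span ℂ (Set.range b)).topologicalClosure
          ≤ W.comap (tensorRight (μ := μ) x).toLinearMap := by
        refine Submodule.topologicalClosure_minimal _ (Submodule.span_le.2 ?_)
          ((Submodule.isClosed_topologicalClosure _).preimage (tensorRight x).continuous)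
        rintro _ ⟨i, rfl⟩
        exact Submodule.le_topologicalClosure _ (Submodule.mem_iSup_of_mem i ⟨x, rfl⟩)
      exact h1 (b.dense_span ▸ Submodule.mem_top)
    refine Lp.induction ENNReal.ofNat_ne_top (motive := fun F => F ∈ W) ?_ ?_ ?_ F
    · intro c s hs hμs
      convert hbx (indicatorConstLp 2 hs hμs.ne (1 : ℂ)) c
      refine Lp.ext ?_
      filter_upwards [coeFn_tensorLp (indicatorConstLp 2 hs hμs.ne (1 : ℂ)) c,
        indicatorConstLp_coeFn (p := 2) (hs := hs) (hμs := hμs.ne) (c := (1 : ℂ)),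
        indicatorConstLp_coeFn (p := 2) (hs := hs) (hμs := hμs.ne) (c := c)] with r h1 h2 h3
      rw [h1, h2, Lp.simpleFunc.coe_indicatorConst, h3]
      by_cases hr : r ∈ s <;> simp [hr]
    · intro f g hf hg _ h1 h2
      exact W.add_mem h1 h2
    · exact Submodule.isClosed_topologicalClosure _

/-- The Hilbert sum decomposition of `L²(X; H)` intertwines the pointwise action of an operator
with its componentwise action. -/
theorem exists_isometry_lp (ι : Type*) (b : HilbertBasis ι ℂ (Lp ℂ 2 μ)) :
    ∃ e : Lp H 2 μ ≃ₗᵢ[ℂ] lp (fun _ : ι => H) 2,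
      ∀ (T : H →L[ℂ] H) (U : Lp H 2 μ) (i : ι), e (T.compLp U) i = T (e U i) := by
  classical
  let hV := isHilbertSum_tensorIsometry (H := H) b
  refine ⟨hV.linearIsometryEquiv, fun T U i => ?_⟩
  -- The coordinate `e F i` is determined by pairing `F` with `b i ⊗ x`, and there `T` moves onto
  -- `x` as its adjoint.
  have hinner : ∀ (F : Lp H 2 μ) (x : H),
      inner ℂ x (hV.linearIsometryEquiv F i) = inner ℂ (tensorLp μ (b i) x) F := by
    intro F x
    have h1 : hV.linearIsometryEquiv.symm (lp.single 2 i x) = tensorLp μ (b i) x :=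
      hV.linearIsometryEquiv_symm_apply_single x
    rw [← h1, ← hV.linearIsometryEquiv.inner_map_map, LinearIsometryEquiv.apply_symm_apply,
      lp.inner_single_left]
  refine ext_inner_left ℂ fun x => ?_
  rw [hinner, ← ContinuousLinearMap.adjoint_inner_left, hinner, L2.inner_def, L2.inner_def]
  refine integral_congr_ae ?_
  filter_upwards [coeFn_tensorLp (b i) x, coeFn_tensorLp (b i) (ContinuousLinearMap.adjoint T x),
    T.coeFn_compLp U] with r h1 h2 h3
  rw [h1, h2, h3, inner_smul_left, inner_smul_left, ContinuousLinearMap.adjoint_inner_left]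

/-- A countable family of vector valued `L²` functions, square summable in norm, defines an element
of the predual by integration. -/
theorem mem_predual_of_hasSum_integral {ω : (H →L[ℂ] H) →L[ℂ] ℂ} (U V : ℕ → Lp H 2 μ)
    (hU : Summable fun k => ‖U k‖ ^ 2) (hV : Summable fun k => ‖V k‖ ^ 2)
    (h : ∀ T : H →L[ℂ] H, HasSum (fun k => ∫ x, inner ℂ (V k x) (T (U k x)) ∂μ) (ω T)) :
    ω ∈ predual H := by
  obtain ⟨w, b, -⟩ := exists_hilbertBasis ℂ (Lp ℂ 2 μ)
  obtain ⟨e, he⟩ := exists_isometry_lp (H := H) w b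
  have hsq : ∀ F : Lp H 2 μ, HasSum (fun i => ‖e F i‖ ^ 2) (‖F‖ ^ 2) := fun F => by
    have := lp.hasSum_norm (p := 2) (by simp) (e F)
    simpa using this
  have hs : ∀ F : ℕ → Lp H 2 μ, Summable (fun k => ‖F k‖ ^ 2) →
      Summable fun q : ℕ × w => ‖e (F q.1) q.2‖ ^ 2 := fun F hF => by
    refine (summable_prod_of_nonneg fun q => by positivity).2
      ⟨fun k => (hsq (F k)).summable, ?_⟩
    simpa only [(hsq _).tsum_eq] using hF
  refine mem_predual_of_hasSum (ι := ℕ × w) (fun q => e (U q.1) q.2) (fun q => e (V q.1) q.2)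
    (hs U hU) (hs V hV) fun T => ?_
  have hsum : Summable fun q : ℕ × w => inner ℂ (e (V q.1) q.2) (T (e (U q.1) q.2)) :=
    Summable.of_norm_bounded (((hs U hU).add (hs V hV)).mul_left ‖T‖)
      fun q => norm_inner_clm_le T _ _
  have hk : ∀ k, HasSum (fun i => inner ℂ (e (V k) i) (T (e (U k) i)))
      (∫ x, inner ℂ (V k x) (T (U k x)) ∂μ) := fun k => by
    have h1 := lp.hasSum_inner (𝕜 := ℂ) (e (V k)) (e (T.compLp (U k)))
    simp only [he] at h1
    rw [e.inner_map_map, L2.inner_def] at h1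
    refine (congrArg (HasSum _) ?_).mp h1
    refine integral_congr_ae ?_
    filter_upwards [T.coeFn_compLp (U k)] with x hx using by rw [hx]
  -- Absolute summability over pairs allows summing over basis coordinates first, which recovers the
  -- integrals.
  obtain ⟨z, hz⟩ := hsum
  have := (hz.prod_fiberwise hk).unique (h T)
  rwa [← this]

end Amplification

/-! ### Orbits of functionals under a family of contractions. -/

section IsometricFamily

/-- Strong continuity of a family of contractions passes to limits of vectors. -/
theorem isClosed_setOf_continuous_orbit {Y A B : Type*} [TopologicalSpace Y]
    [PseudoMetricSpace A] [PseudoMetricSpace B] (L : Y → A → B)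
    (hL : ∀ y a a', dist (L y a) (L y a') ≤ dist a a') :
    IsClosed {a | Continuous fun y => L y a} := by
  refine isClosed_of_closure_subset fun a ha => ?_
  refine continuous_of_uniform_approx_of_continuous fun u hu => ?_
  obtain ⟨ε, hε, hu⟩ := Metric.mem_uniformity_dist.1 hu
  obtain ⟨a', ha', hd⟩ := Metric.mem_closure_iff.1 ha ε hε
  exact ⟨fun y => L y a', ha', fun y => hu ((hL y a a').trans_lt hd)⟩

variable {Y A : Type*} [TopologicalSpace Y] [NormedAddCommGroup A] [NormedSpace ℂ A]
  {α : Y → A →L[ℂ] A}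

theorem norm_comp_le_of_contraction (hα : ∀ r T, ‖α r T‖ ≤ ‖T‖) (r : Y) (φ : A →L[ℂ] ℂ) :
    ‖φ.comp (α r)‖ ≤ ‖φ‖ := by
  refine ContinuousLinearMap.opNorm_le_bound _ (norm_nonneg φ) fun T => ?_
  exact (φ.le_opNorm _).trans (by gcongr; exact hα r T)

/-- Functionals with norm continuous orbit form a closed set, and the partial sums lie in it. This
reduces the predual to vector functionals. -/
theorem continuous_comp_of_hasSum (hα : ∀ r T, ‖α r T‖ ≤ ‖T‖) {φ : ℕ → A →L[ℂ] ℂ}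
    (hφ : ∀ i, Continuous fun r => (φ i).comp (α r)) {ψ : A →L[ℂ] ℂ} (h : HasSum φ ψ) :
    Continuous fun r => ψ.comp (α r) := by
  have hcl := isClosed_setOf_continuous_orbit (fun r (φ : A →L[ℂ] ℂ) => φ.comp (α r))
    fun r φ φ' => by
      rw [dist_eq_norm, dist_eq_norm, ← ContinuousLinearMap.sub_comp]
      exact norm_comp_le_of_contraction hα r _
  refine hcl.mem_of_tendsto h (.of_forall fun s => ?_)
  simp only [Set.mem_ofPred_eq, ContinuousLinearMap.finsetSum_comp]
  exact continuous_finsetSum _ fun i _ => hφ i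

variable [T2Space Y] [LocallyCompactSpace Y] [MeasurableSpace Y] [BorelSpace Y] {μ : Measure Y}
  [IsLocallyFiniteMeasure μ] [InnerRegularCompactLTTop μ]

theorem integrable_smul_comp (hα : ∀ r T, ‖α r T‖ ≤ ‖T‖) {φ : A →L[ℂ] ℂ}
    (hφ : Continuous fun r => φ.comp (α r)) (f : Lp ℂ 1 μ) :
    Integrable (fun r => f r • φ.comp (α r)) μ :=
  integrable_smul_bcf f (BoundedContinuousFunction.ofNormedAddCommGroup _ hφ ‖φ‖
    fun r => norm_comp_le_of_contraction hα r φ)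

theorem integral_smul_comp_apply (hα : ∀ r T, ‖α r T‖ ≤ ‖T‖) {φ : A →L[ℂ] ℂ}
    (hφ : Continuous fun r => φ.comp (α r)) (f : Lp ℂ 1 μ) (T : A) :
    (∫ r, f r • φ.comp (α r) ∂μ) T = ∫ r, f r * φ (α r T) ∂μ :=
  ContinuousLinearMap.integral_apply (φ := fun r => f r • φ.comp (α r))
    (integrable_smul_comp hα hφ f) T

/-- Sum and integral are exchanged under the bounds `‖f r‖ * (b i * ‖T‖)`, whose integrals are
summable in `i`. -/
theorem hasSum_integral_mul_comp (hα : ∀ r T, ‖α r T‖ ≤ ‖T‖) {φ : ℕ → A →L[ℂ] ℂ}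
    (hφ : ∀ i, Continuous fun r => (φ i).comp (α r)) {b : ℕ → ℝ} (hb : ∀ i, ‖φ i‖ ≤ b i)
    (hs : Summable b) {ψ : A →L[ℂ] ℂ} (h : HasSum φ ψ) (f : Lp ℂ 1 μ) (T : A) :
    HasSum (fun i => ∫ r, f r * φ i (α r T) ∂μ) (∫ r, f r * ψ (α r T) ∂μ) := by
  have hint : ∀ i, Integrable (fun r => f r * φ i (α r T)) μ := fun i =>
    (integrable_smul_comp hα (hφ i) f).apply_continuousLinearMap T
  have hle : ∀ i r, ‖f r * φ i (α r T)‖ ≤ ‖f r‖ * (b i * ‖T‖) := fun i r => by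
    rw [norm_mul]
    gcongr
    exact ((φ i).le_opNorm _).trans (mul_le_mul (hb i) (hα r T) (norm_nonneg _)
      ((norm_nonneg _).trans (hb i)))
  have hsum := hasSum_integral_of_summable_integral_norm hint
    (Summable.of_nonneg_of_le (fun i => integral_nonneg fun r => norm_nonneg _)
      (fun i => integral_mono (hint i).norm ((L1.integrable_coeFn f).norm.mul_const _) (hle i))
      (by simpa only [integral_mul_const] using (hs.mul_right ‖T‖).mul_left _))
  refine (congrArg (HasSum _) (integral_congr_ae (.of_forall fun r => ?_))).mp hsum
  exact (((h.mapL (ContinuousLinearMap.apply ℂ ℂ (α r T))).mul_left (f r)).tsum_eq)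

/-- The integral is Lipschitz in `Φ z` with constant `‖f‖ * ‖T‖`. It serves to pass from `C_c`
vectors to all of `L²(G)`. -/
theorem continuous_integral_mul_comp (hα : ∀ r T, ‖α r T‖ ≤ ‖T‖) {Z : Type*}
    [TopologicalSpace Z] {Φ : Z → A →L[ℂ] ℂ} (hΦ : Continuous Φ)
    (hc : ∀ z, Continuous fun r => (Φ z).comp (α r)) (f : Lp ℂ 1 μ) (T : A) :
    Continuous fun z => ∫ r, f r * Φ z (α r T) ∂μ := by
  have hint : ∀ z, Integrable (fun r => f r * Φ z (α r T)) μ := fun z =>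
    (integrable_smul_comp hα (hc z) f).apply_continuousLinearMap T
  have hle : ∀ z z', ‖(∫ r, f r * Φ z (α r T) ∂μ) - ∫ r, f r * Φ z' (α r T) ∂μ‖
      ≤ ‖f‖ * (‖Φ z - Φ z'‖ * ‖T‖) := fun z z' => by
    rw [← integral_sub (hint z) (hint z'), L1.norm_eq_integral_norm, ← integral_mul_const]
    refine norm_integral_le_of_norm_le ((L1.integrable_coeFn f).norm.mul_const _)
      (.of_forall fun r => ?_)
    rw [← mul_sub, norm_mul]
    gcongr
    exact ((Φ z - Φ z').le_opNorm _).trans (by gcongr; exact hα r T)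
  refine continuous_iff_continuousAt.2 fun z => tendsto_iff_norm_sub_tendsto_zero.2 ?_
  refine squeeze_zero (fun _ => norm_nonneg _) (fun z' => hle z' z) ?_
  have h : Continuous fun z' => ‖f‖ * (‖Φ z' - Φ z‖ * ‖T‖) := by fun_prop
  simpa using h.tendsto z

theorem apply_eq_zero_of_mem_closure_span {S : Set (A →L[ℂ] ℂ)} {T : A}
    (h : ∀ φ ∈ S, φ T = 0) : ∀ φ ∈ (Submodule.span ℂ S).topologicalClosure, φ T = 0 := by
  have hle : (Submodule.span ℂ S).topologicalClosure
      ≤ LinearMap.ker (ContinuousLinearMap.apply ℂ ℂ T).toLinearMap :=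
    Submodule.topologicalClosure_minimal _ (Submodule.span_le.2 fun φ hφ => h φ hφ)
      (ContinuousLinearMap.apply ℂ ℂ T).isClosed_ker
  exact fun φ hφ => hle hφ

end IsometricFamily

/-! ### The modular function and the regular representations. -/

section Group

variable {G : Type*} [Group G] [TopologicalSpace G] [IsTopologicalGroup G]
  [LocallyCompactSpace G] [MeasurableSpace G] [BorelSpace G]

/-- The support of `F r` moves with `r`, but for `r` in a compact neighbourhood `t` it stays in the
compact set `K * t⁻¹`. -/
theorem continuous_integral_of_mul_mem {E : Type*} [NormedAddCommGroup E] [NormedSpace ℝ E]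
    {μ : Measure G} [IsFiniteMeasureOnCompacts μ] {F : G → G → E} (hF : Continuous F.uncurry)
    {K : Set G} (hK : IsCompact K) (h : ∀ r y, F r y ≠ 0 → y * r ∈ K) :
    Continuous fun r => ∫ y, F r y ∂μ := by
  refine continuous_iff_continuousAt.2 fun r₀ => ?_
  obtain ⟨t, t_comp, ht⟩ := exists_compact_mem_nhds r₀
  refine (continuousOn_integral_of_compact_support (s := t) (hK.mul t_comp.inv) hF.continuousOn
    fun r y hr hy => ?_).continuousAt ht
  contrapose! hy
  exact ⟨y * r, h r y hy, r⁻¹, Set.inv_mem_inv.2 hr, by simp⟩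

theorem integral_mul_right_eq_modularCharacterFun {E : Type*} [NormedAddCommGroup E]
    [NormedSpace ℝ E] (μ : Measure G) [IsHaarMeasure μ] [InnerRegular μ] (r : G) (k : G → E) :
    ∫ y, k (y * r) ∂μ = (modularCharacterFun r : ℝ) • ∫ y, k y ∂μ := by
  have h := (Homeomorph.mulRight r).measurableEmbedding.integral_map (μ := μ) k
  simp only [Homeomorph.coe_mulRight] at h
  rw [← h, map_right_mul_eq_modularCharacterFun_smul, integral_smul_nnreal_measure]
  rfl

/-- The character at `r` is the ratio of `∫ k (y * r)` to `∫ k` for a fixed bump function `k`. -/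
theorem continuous_modularCharacterFun [T2Space G] (μ : Measure G) [IsHaarMeasure μ]
    [InnerRegular μ] : Continuous (modularCharacterFun : G → ℝ≥0) := by
  obtain ⟨k, hk1, -, hkc, hk0⟩ := exists_continuous_one_zero_of_isCompact
    (isCompact_singleton (x := (1 : G))) isClosed_empty (Set.disjoint_empty _)
  have hpos : 0 < ∫ y, k y ∂μ :=
    k.continuous.integral_pos_of_hasCompactSupport_nonneg_nonzero hkc (fun y => (hk0 y).1)
      (x := 1) (by rw [hk1 rfl]; simp)
  have h1 : Continuous fun r : G => ∫ y, k (y * r) ∂μ :=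
    continuous_integral_of_mul_mem (F := fun r y => k (y * r))
      (by simp only [Function.uncurry_def]; fun_prop) hkc fun r y hy => subset_tsupport _ hy
  refine NNReal.isEmbedding_coe.continuous_iff.2 ?_
  convert h1.div_const (∫ y, k y ∂μ) using 2 with r
  rw [Function.comp_apply, integral_mul_right_eq_modularCharacterFun, smul_eq_mul,
    mul_div_cancel_right₀ _ hpos.ne']

theorem continuous_modularFn [T2Space G] (μ : Measure G) [IsHaarMeasure μ]
    [InnerRegular μ] : Continuous (modularFn : G → ℝ≥0) :=
  (continuous_modularCharacterFun μ).inv₀ fun r => (modularCharacterFun_pos r).ne'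

theorem modularFn_mul (r s : G) : modularFn (r * s) = modularFn r * modularFn s := by
  simp [modularFn, modularCharacterFun_map_mul, mul_comm]

theorem modularFn_inv_eq (r : G) : modularFn r⁻¹ = modularCharacterFun r := by
  have h := modularCharacterFun_map_mul r r⁻¹
  rw [mul_inv_cancel, modularCharacterFun_map_one] at h
  rw [modularFn]
  exact (eq_inv_of_mul_eq_one_left h.symm).symm

section RightRegular

variable {μ : Measure G} [IsHaarMeasure μ] [InnerRegular μ]

theorem coeFn_rightReg (r : G) (f : Lp ℂ 2 μ) :
    rightReg μ r f =ᵐ[μ] fun s => ((Real.sqrt (modularFn r) : ℝ) : ℂ) * f (s * r) := by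
  have h1 := Lp.coeFn_smul ((Real.sqrt (modularFn r) : ℝ) : ℂ)
    ((memLp_rightTranslate r f).toLp (fun s => f (s * r)))
  filter_upwards [h1, (memLp_rightTranslate r f).coeFn_toLp] with s h1 h2
  refine Eq.trans h1 ?_
  rw [Pi.smul_apply, h2, smul_eq_mul]

theorem coeFn_leftReg {p : ℝ≥0∞} [Fact (1 ≤ p)] (s : G) (f : Lp ℂ p μ) :
    leftReg p μ s f =ᵐ[μ] fun t => f (s⁻¹ * t) :=
  Lp.coeFn_compMeasurePreserving f (measurePreserving_mul_left μ s⁻¹)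

theorem rightReg_rightReg_inv (r : G) (f : Lp ℂ 2 μ) :
    rightReg μ r (rightReg μ r⁻¹ f) = f := by
  refine Lp.ext ?_
  filter_upwards [coeFn_rightReg r (rightReg μ r⁻¹ f),
    ae_rightTranslate r (coeFn_rightReg r⁻¹ f)] with s h1 h2
  rw [h1, h2, ← mul_assoc, ← Complex.ofReal_mul, ← Real.sqrt_mul (by positivity),
    ← NNReal.coe_mul, ← modularFn_mul]
  simp [modularFn, modularCharacterFun_map_one]

theorem adjoint_rightReg (r : G) :
    ContinuousLinearMap.adjoint (rightReg μ r).toContinuousLinearMap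
      = (rightReg μ r⁻¹).toContinuousLinearMap := by
  ext1 f
  refine ext_inner_left ℂ fun g => ?_
  rw [ContinuousLinearMap.adjoint_inner_right]
  conv_lhs => rw [← rightReg_rightReg_inv r f]
  exact (rightReg μ r).inner_map_map _ _

theorem leftReg_rightReg (s r : G) (f : Lp ℂ 2 μ) :
    leftReg 2 μ s (rightReg μ r f) = rightReg μ r (leftReg 2 μ s f) := by
  refine Lp.ext ?_
  filter_upwards [coeFn_leftReg s (rightReg μ r f), coeFn_rightReg r (leftReg 2 μ s f),
    (measurePreserving_mul_left μ s⁻¹).quasiMeasurePreserving.ae (coeFn_rightReg r f),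
    ae_rightTranslate r (coeFn_leftReg s f)] with t h1 h2 h3 h4
  rw [h1, h3, h2, h4, mul_assoc]

theorem leftReg_one : leftReg 2 μ (1 : G) = 1 := by
  ext1 f
  refine Lp.ext ?_
  filter_upwards [coeFn_leftReg 1 f] with t ht
  rw [ht]; simp

variable [T2Space G]

/-- Because the operators are isometries, it suffices to treat `f` in `C_c`. There `‖ρ_r f - ρ_{r₀}
f‖² = 2‖f‖² - 2 Re (ρ_{r₀} f, ρ_r f)`, and the inner product is an integral of a jointly continuous
kernel. -/
theorem continuous_rightReg (f : Lp ℂ 2 μ) : Continuous fun r => rightReg μ r f := by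
  have hcl := isClosed_setOf_continuous_orbit (fun r (f : Lp ℂ 2 μ) => rightReg μ r f)
    fun r f g => ((rightReg μ r).dist_map f g).le
  have := (dense_compactlySupportedLp μ (p := 2) ENNReal.ofNat_ne_top).closure_eq
  suffices h : closure (compactlySupportedLp μ 2) ⊆ {a | Continuous fun y => rightReg μ y a} from
    h (this ▸ Set.mem_univ f)
  refine closure_minimal ?_ hcl
  rintro f ⟨φ, hφ, hc, he⟩
  have hcoe : ∀ r, rightReg μ r f =ᵐ[μ]
      fun s => ((Real.sqrt (modularFn r) : ℝ) : ℂ) * φ (s * r) := fun r => by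
    filter_upwards [coeFn_rightReg r f, ae_rightTranslate r he] with s h1 h2
    rw [h1, h2]
  have hinner : ∀ r₀, Continuous fun r => inner ℂ (rightReg μ r₀ f) (rightReg μ r f) := by
    intro r₀
    have : (fun r => inner ℂ (rightReg μ r₀ f) (rightReg μ r f)) = fun r =>
        ∫ s, (inner ℂ (((Real.sqrt (modularFn r₀) : ℝ) : ℂ) * φ (s * r₀))
          (((Real.sqrt (modularFn r) : ℝ) : ℂ) * φ (s * r)) : ℂ) ∂μ := by
      funext r
      rw [L2.inner_def]
      refine integral_congr_ae ?_
      filter_upwards [hcoe r, hcoe r₀] with s h1 h2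
      rw [h1, h2]
    rw [this]
    refine continuous_integral_of_mul_mem ?_ (K := tsupport φ) hc ?_
    · have := continuous_modularFn μ
      simp only [Function.uncurry_def]
      fun_prop
    · intro r y hy
      refine subset_tsupport φ fun h0 => hy ?_
      simp [h0]
  refine continuous_iff_continuousAt.2 fun r₀ => ?_
  refine tendsto_iff_norm_sub_tendsto_zero.2 ?_
  have h2 : Filter.Tendsto (fun r => ‖f‖ ^ 2 - 2 * RCLike.re (inner ℂ (rightReg μ r₀ f)
      (rightReg μ r f)) + ‖f‖ ^ 2) (𝓝 r₀) (𝓝 0) := by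
    have h3 : Continuous fun r => ‖f‖ ^ 2 - 2 * RCLike.re (inner ℂ (rightReg μ r₀ f)
      (rightReg μ r f)) + ‖f‖ ^ 2 := by
      have := hinner r₀
      fun_prop
    convert h3.tendsto r₀
    rw [inner_self_eq_norm_sq, LinearIsometry.norm_map]
    ring
  have h4 := h2.sqrt
  rw [Real.sqrt_zero] at h4
  refine h4.congr fun r => ?_
  rw [← Real.sqrt_sq (norm_nonneg (rightReg μ r f - rightReg μ r₀ f)), norm_sub_rev,
    @norm_sub_sq ℂ, LinearIsometry.norm_map, LinearIsometry.norm_map]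

theorem continuous_leftReg (f : Lp ℂ 1 μ) : Continuous fun y => leftReg 1 μ y f := by
  let m : C(G, C(G, G)) :=
    ContinuousMap.curry ⟨fun q : G × G => q.1⁻¹ * q.2, by fun_prop⟩
  exact (continuous_const (y := f)).compMeasurePreservingLp m.continuous
    (fun y => measurePreserving_mul_left μ y⁻¹) ENNReal.one_ne_top

theorem norm_leftReg (y : G) (f : Lp ℂ 1 μ) : ‖leftReg 1 μ y f‖ = ‖f‖ :=
  Lp.norm_compMeasurePreserving f (measurePreserving_mul_left μ y⁻¹)

variable (μ) in
/-- The orbit `y ↦ λ_y f` of `f ∈ L¹(G)` as a bounded continuous function, linearly in `f`. -/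
noncomputable def leftOrbit : Lp ℂ 1 μ →L[ℂ] (G →ᵇ Lp ℂ 1 μ) :=
  LinearMap.mkContinuous
    { toFun f := BoundedContinuousFunction.ofNormedAddCommGroup (fun y => leftReg 1 μ y f)
        (continuous_leftReg f) ‖f‖ fun y => (norm_leftReg y f).le
      map_add' f g := by ext1 y; exact map_add (leftReg 1 μ y) f g
      map_smul' c f := by ext1 y; exact map_smul (leftReg 1 μ y) c f } 1
    fun f => (BoundedContinuousFunction.norm_ofNormedAddCommGroup_le (continuous_leftReg f)
      (norm_nonneg f) fun y => (norm_leftReg y f).le).trans (one_mul _).ge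

/-- This form shows that convolution is continuous in `f`, so identities extend from the dense set
`C_c`. -/
theorem conv_eq_integralPairing (g f : Lp ℂ 1 μ) :
    conv μ g f = integralPairing μ _ g (leftOrbit μ f) := rfl

theorem thetaPt_vecFun (r : G) (u v : Lp ℂ 2 μ) :
    thetaPt μ r (vecFun u v) = vecFun (rightReg μ r⁻¹ u) (rightReg μ r⁻¹ v) := by
  ext T
  change inner ℂ v ((rightReg μ r).toContinuousLinearMap (T (ContinuousLinearMap.adjoint
    (rightReg μ r).toContinuousLinearMap u))) = _
  rw [← ContinuousLinearMap.adjoint_inner_left, adjoint_rightReg]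
  rfl

theorem norm_adOp_rightReg_apply_le (r : G) (T : Lp ℂ 2 μ →L[ℂ] Lp ℂ 2 μ) :
    ‖adOp (rightReg μ r).toContinuousLinearMap T‖ ≤ ‖T‖ := by
  refine ContinuousLinearMap.opNorm_le_bound _ (norm_nonneg T) fun u => ?_
  change ‖rightReg μ r (T (ContinuousLinearMap.adjoint
    (rightReg μ r).toContinuousLinearMap u))‖ ≤ _
  rw [adjoint_rightReg, LinearIsometry.norm_map]
  refine (T.le_opNorm _).trans ?_
  rw [LinearIsometry.coe_toContinuousLinearMap, LinearIsometry.norm_map]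

theorem continuous_thetaPt_vecFun (u v : Lp ℂ 2 μ) :
    Continuous fun r => thetaPt μ r (vecFun u v) := by
  simp only [thetaPt_vecFun]
  exact continuous_vecFun ((continuous_rightReg u).comp continuous_inv)
    ((continuous_rightReg v).comp continuous_inv)

/-- On the predual, the maps `θ_r` depend on `r` continuously in norm. -/
theorem continuous_thetaPt {ω : (Lp ℂ 2 μ →L[ℂ] Lp ℂ 2 μ) →L[ℂ] ℂ}
    (hω : ω ∈ predual (Lp ℂ 2 μ)) : Continuous fun r => thetaPt μ r ω := by
  obtain ⟨f, g, -, -, h⟩ := exists_hasSum_vecFun hω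
  exact continuous_comp_of_hasSum (A := Lp ℂ 2 μ →L[ℂ] Lp ℂ 2 μ) norm_adOp_rightReg_apply_le
    (fun i => continuous_thetaPt_vecFun (f i) (g i)) h

/-- Evaluation at `T` passes under the Bochner integral once the integrand is integrable, which
membership in the predual guarantees through norm continuity of the orbit. -/
theorem theta_apply (f : Lp ℂ 1 μ) {ω : (Lp ℂ 2 μ →L[ℂ] Lp ℂ 2 μ) →L[ℂ] ℂ}
    (hω : ω ∈ predual (Lp ℂ 2 μ)) (T : Lp ℂ 2 μ →L[ℂ] Lp ℂ 2 μ) :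
    theta μ f ω T = ∫ r, f r * ω (adOp (rightReg μ r).toContinuousLinearMap T) ∂μ :=
  integral_smul_comp_apply (A := Lp ℂ 2 μ →L[ℂ] Lp ℂ 2 μ) norm_adOp_rightReg_apply_le
    (continuous_thetaPt hω) f T

end RightRegular

end Group

/-! ### Splitting an `L¹` density into two `L²` factors. -/

section SquareRoot

variable {X : Type*} [TopologicalSpace X] [T2Space X] [LocallyCompactSpace X] [MeasurableSpace X]
  [BorelSpace X] {μ : Measure X} [IsLocallyFiniteMeasure μ] [InnerRegularCompactLTTop μ]
  {H : Type*} [NormedAddCommGroup H] [InnerProductSpace ℂ H]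

/-- The scalar of modulus `|f|^{1/2}` is kept in the form `m * f` because it is the factor `f` that
makes `f • Φ` strongly measurable. -/
theorem exists_Lp_two_of_sqrt_smul (f : Lp ℂ 1 μ) {m : X → ℂ} (hm : AEStronglyMeasurable m μ)
    (h : ∀ x, ‖m x * f x‖ ^ 2 = ‖f x‖) {Φ : X → H} (hΦ : Continuous Φ) {C : ℝ}
    (hC : ∀ x, ‖Φ x‖ = C) :
    ∃ U : Lp H 2 μ, U =ᵐ[μ] (fun x => (m x * f x) • Φ x) ∧ ‖U‖ ^ 2 = ‖f‖ * C ^ 2 := by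
  have haesm : AEStronglyMeasurable (fun x => (m x * f x) • Φ x) μ := by
    simp only [mul_smul]
    exact hm.smul (aestronglyMeasurable_smul_of_continuous f hΦ)
  have hnorm : ∀ x, ‖(m x * f x) • Φ x‖ ^ 2 = ‖f x‖ * C ^ 2 := fun x => by
    rw [norm_smul, mul_pow, h, hC]
  have hmem : MemLp (fun x => (m x * f x) • Φ x) 2 μ := by
    rw [memLp_two_iff_integrable_sq_norm haesm]
    simpa only [hnorm] using (L1.integrable_coeFn f).norm.mul_const _
  refine ⟨hmem.toLp _, hmem.coeFn_toLp, ?_⟩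
  rw [← inner_self_eq_norm_sq (𝕜 := ℂ), L2.inner_def, L1.norm_eq_integral_norm,
    ← integral_mul_const]
  have h1 : ∫ x, inner ℂ (hmem.toLp _ x) (hmem.toLp _ x) ∂μ
      = ∫ x, ((‖f x‖ * C ^ 2 : ℝ) : ℂ) ∂μ := by
    refine integral_congr_ae ?_
    filter_upwards [hmem.coeFn_toLp] with x hx
    rw [hx, inner_self_eq_norm_sq_to_K, ← hnorm]
    simp
  rw [h1, integral_complex_ofReal]
  exact Complex.ofReal_re _

end SquareRoot

/-! ### Invariance of the predual under `θ(f)`. -/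

section Group

variable {G : Type*} [Group G] [TopologicalSpace G] [IsTopologicalGroup G]
  [LocallyCompactSpace G] [T2Space G] [MeasurableSpace G] [BorelSpace G]
  {μ : Measure G} [IsHaarMeasure μ] [InnerRegular μ]

theorem vecFun_adOp_rightReg (r : G) (u v : Lp ℂ 2 μ) (T : Lp ℂ 2 μ →L[ℂ] Lp ℂ 2 μ) :
    vecFun u v (adOp (rightReg μ r).toContinuousLinearMap T)
      = inner ℂ (rightReg μ r⁻¹ v) (T (rightReg μ r⁻¹ u)) :=
  DFunLike.congr_fun (thetaPt_vecFun r u v) T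

/-- The series representing an element of the predual is preserved by `θ(f)`. -/
theorem hasSum_theta_apply {u v : ℕ → Lp ℂ 2 μ} (hu : Summable fun i => ‖u i‖ ^ 2)
    (hv : Summable fun i => ‖v i‖ ^ 2) {ω : (Lp ℂ 2 μ →L[ℂ] Lp ℂ 2 μ) →L[ℂ] ℂ}
    (hω : ω ∈ predual (Lp ℂ 2 μ)) (h : HasSum (fun i => vecFun (u i) (v i)) ω) (f : Lp ℂ 1 μ)
    (T : Lp ℂ 2 μ →L[ℂ] Lp ℂ 2 μ) :
    HasSum (fun i => theta μ f (vecFun (u i) (v i)) T) (theta μ f ω T) := by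
  rw [theta_apply f hω T]
  simp only [theta_apply f (vecFun_mem_predual _ _) T]
  exact hasSum_integral_mul_comp (A := Lp ℂ 2 μ →L[ℂ] Lp ℂ 2 μ) norm_adOp_rightReg_apply_le
    (fun i => continuous_thetaPt_vecFun (u i) (v i))
    (fun i => norm_vecFun_le_add (u i) (v i)) (hu.add hv) h f T

/-- The maps `θ(f)` leave the predual invariant. -/
theorem theta_mem_predual (f : Lp ℂ 1 μ) {ω : (Lp ℂ 2 μ →L[ℂ] Lp ℂ 2 μ) →L[ℂ] ℂ}
    (hω : ω ∈ predual (Lp ℂ 2 μ)) : theta μ f ω ∈ predual (Lp ℂ 2 μ) := by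
  obtain ⟨u, v, hu, hv, h⟩ := exists_hasSum_vecFun hω
  have hf : AEStronglyMeasurable (fun r => f r) μ := Lp.aestronglyMeasurable f
  have hsq : AEStronglyMeasurable (fun r => ((Real.sqrt ‖f r‖ : ℝ) : ℂ)) μ :=
    Complex.continuous_ofReal.comp_aestronglyMeasurable
      (Real.continuous_sqrt.comp_aestronglyMeasurable hf.norm)
  have hΦ : ∀ w : Lp ℂ 2 μ, Continuous fun r : G => rightReg μ r⁻¹ w := fun w =>
    (continuous_rightReg w).comp continuous_inv
  have hN : ∀ (w : Lp ℂ 2 μ) (r : G), ‖rightReg μ r⁻¹ w‖ = ‖w‖ := fun w r =>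
    (rightReg μ r⁻¹).norm_map w
  have hnorm_a : ∀ r, ‖((Real.sqrt ‖f r‖ : ℝ) : ℂ)⁻¹ * f r‖ ^ 2 = ‖f r‖ := fun r => by
    rw [norm_mul, norm_inv, Complex.norm_real, mul_pow, inv_pow,
      Real.norm_of_nonneg (Real.sqrt_nonneg _), Real.sq_sqrt (norm_nonneg _)]
    by_cases h0 : ‖f r‖ = 0
    · simp [h0]
    · field_simp
  have hb_eq : ∀ r, ((Real.sqrt ‖f r‖ : ℝ) : ℂ) / f r * f r = ((Real.sqrt ‖f r‖ : ℝ) : ℂ) := by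
    intro r
    by_cases h0 : f r = 0
    · simp [h0]
    · rw [div_mul_cancel₀ _ h0]
  have hnorm_b : ∀ r, ‖((Real.sqrt ‖f r‖ : ℝ) : ℂ) / f r * f r‖ ^ 2 = ‖f r‖ := fun r => by
    rw [hb_eq, Complex.norm_real, Real.norm_of_nonneg (Real.sqrt_nonneg _),
      Real.sq_sqrt (norm_nonneg _)]
  -- With `s = |f|^{1/2}`, almost everywhere `U k = (s⁻¹ * f) • ρ_{r⁻¹} (u k)` and `V k = s •
  -- ρ_{r⁻¹} (v k)`, so the scalars multiply back to `f`. Where `f` vanishes, the convention `0⁻¹ =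
  -- 0` makes both zero.
  choose U hU hUn using fun k => exists_Lp_two_of_sqrt_smul f (hsq.inv₀) hnorm_a (hΦ (u k))
    (hN (u k))
  choose V hV hVn using fun k => exists_Lp_two_of_sqrt_smul f (hsq.div₀ hf) hnorm_b (hΦ (v k))
    (hN (v k))
  refine mem_predual_of_hasSum_integral U V (by simpa only [hUn] using hu.mul_left _)
    (by simpa only [hVn] using hv.mul_left _) fun T => ?_
  convert hasSum_theta_apply hu hv hω h f T using 2 with k
  rw [theta_apply f (vecFun_mem_predual _ _) T]
  refine integral_congr_ae ?_
  filter_upwards [hU k, hV k] with r h1 h2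
  rw [h1, h2, Pi.div_apply, Pi.inv_apply, hb_eq, map_smul, inner_smul_left, inner_smul_right, vecFun_adOp_rightReg,
    ← mul_assoc, ← mul_assoc]
  congr 1
  by_cases h0 : f r = 0
  · simp [h0]
  · rw [Complex.conj_ofReal, mul_inv_cancel₀, one_mul]
    simpa using h0

end Group

/-! ### Fubini's theorem on compact supports. -/

section Fubini

variable {X Y : Type*} [TopologicalSpace X] [TopologicalSpace Y] [MeasurableSpace X]
  [MeasurableSpace Y] [OpensMeasurableSpace X] [OpensMeasurableSpace Y] {μ : Measure X}
  {ν : Measure Y} [IsFiniteMeasureOnCompacts μ] [IsFiniteMeasureOnCompacts ν]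

/-- Fubini's theorem for the product of an essentially bounded function of one variable and a
continuous function with compact support, without σ-finiteness. -/
theorem integral_integral_swap_mul_of_hasCompactSupport (a : Lp ℂ ∞ μ) {Ψ : X → Y → ℂ}
    (hΨ : Continuous Ψ.uncurry) (hc : HasCompactSupport Ψ.uncurry) :
    ∫ y, (∫ x, a x * Ψ x y ∂μ) ∂ν = ∫ x, a x * (∫ y, Ψ x y ∂ν) ∂μ := by
  let U := Prod.fst '' tsupport Ψ.uncurry
  have hU : μ U < ∞ := (IsCompact.image hc continuous_fst).measure_lt_top
  have : Fact (μ U < ∞) := ⟨hU⟩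
  let V := Prod.snd '' tsupport Ψ.uncurry
  have hV : ν V < ∞ := (IsCompact.image hc continuous_snd).measure_lt_top
  have : Fact (ν V < ∞) := ⟨hV⟩
  have hxU : ∀ x, x ∉ U → ∀ y, Ψ x y = 0 := fun x hx y => by
    contrapose! hx
    exact Set.mem_image_of_mem Prod.fst (subset_tsupport Ψ.uncurry (a := (x, y)) hx)
  have hyV : ∀ y, y ∉ V → ∀ x, Ψ x y = 0 := fun y hy x => by
    contrapose! hy
    exact Set.mem_image_of_mem Prod.snd (subset_tsupport Ψ.uncurry (a := (x, y)) hy)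
  have ha : Integrable (fun x => a x) (μ.restrict U) :=
    ((Lp.memLp a).restrict U).integrable le_top
  have hint : Integrable (fun q : X × Y => a q.1 * Ψ q.1 q.2)
      ((μ.restrict U).prod (ν.restrict V)) := by
    obtain ⟨C, hC⟩ : ∃ C, ∀ p, ‖Ψ.uncurry p‖ ≤ C := hΨ.bounded_above_of_compact_support hc
    have h1 : Integrable (fun q : X × Y => a q.1 * (1 : ℂ))
        ((μ.restrict U).prod (ν.restrict V)) := ha.mul_prod (integrable_const 1)
    simp only [mul_one] at h1
    exact h1.mul_bdd (c := C) (hc.stronglyMeasurable_of_prod hΨ).aestronglyMeasurable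
      (.of_forall hC)
  calc ∫ y, (∫ x, a x * Ψ x y ∂μ) ∂ν = ∫ y, (∫ x in U, a x * Ψ x y ∂μ) ∂ν := by
        congr 1 with y
        refine (setIntegral_eq_integral_of_forall_compl_eq_zero fun x hx => ?_).symm
        rw [hxU x hx, mul_zero]
    _ = ∫ y in V, (∫ x in U, a x * Ψ x y ∂μ) ∂ν := by
        refine (setIntegral_eq_integral_of_forall_compl_eq_zero fun y hy => ?_).symm
        simp [hyV y hy]
    _ = ∫ x in U, (∫ y in V, a x * Ψ x y ∂ν) ∂μ := (integral_integral_swap hint).symm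
    _ = ∫ x, (∫ y in V, a x * Ψ x y ∂ν) ∂μ := by
        refine setIntegral_eq_integral_of_forall_compl_eq_zero fun x hx => ?_
        simp [hxU x hx]
    _ = ∫ x, a x * (∫ y, Ψ x y ∂ν) ∂μ := by
        congr 1 with x
        rw [← integral_const_mul]
        refine setIntegral_eq_integral_of_forall_compl_eq_zero fun y hy => ?_
        rw [hyV y hy, mul_zero]

end Fubini

/-! ### Convolution and the action of `θ(f)` on multiplication operators. -/

section Group

open scoped Pointwise

variable {G : Type*} [Group G] [TopologicalSpace G] [IsTopologicalGroup G]
  [LocallyCompactSpace G] [T2Space G] [MeasurableSpace G] [BorelSpace G]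
  {μ : Measure G} [IsHaarMeasure μ] [InnerRegular μ]

/-- The inversion formula for left Haar measure. -/
theorem integral_eq_integral_modularCharacterFun_mul_inv {g : G → ℂ} (hg : Continuous g)
    (hgc : HasCompactSupport g) :
    ∫ s, g s ∂μ = ∫ r, ((modularCharacterFun r : ℝ) : ℂ) * g r⁻¹ ∂μ := by
  obtain ⟨k, hk1, -, hkc, hk0⟩ := exists_continuous_one_zero_of_isCompact
    (isCompact_singleton (x := (1 : G))) isClosed_empty (Set.disjoint_empty _)
  have hpos : 0 < ∫ y, k y ∂μ :=
    k.continuous.integral_pos_of_hasCompactSupport_nonneg_nonzero hkc (fun y => (hk0 y).1)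
      (x := 1) (by rw [hk1 rfl]; simp)
  let h : G → ℂ := fun y => (k y : ℂ)
  have hh : Continuous h := by fun_prop
  have hhc : HasCompactSupport h := hkc.comp_left (g := fun y : ℝ => (y : ℂ)) (by simp)
  have hne : ∫ y, h y ∂μ ≠ 0 := by
    simp only [h]
    rw [integral_complex_ofReal]
    exact_mod_cast hpos.ne'
  -- Both sides are multiplied by `∫ h`, which absorbs the character as `∫ h (s * r)`. Two Fubini
  -- swaps around the left translation `r ↦ s⁻¹ * r` then give the claim.
  refine mul_left_cancel₀ hne (Eq.symm ?_)
  have hK : IsCompact (tsupport h * tsupport g) := hhc.isCompact.mul hgc.isCompact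
  calc (∫ y, h y ∂μ) * ∫ r, ((modularCharacterFun r : ℝ) : ℂ) * g r⁻¹ ∂μ
      = ∫ r, (∫ s, h (s * r) * g r⁻¹ ∂μ) ∂μ := by
        rw [← integral_const_mul]
        congr 1 with r
        rw [integral_mul_const, integral_mul_right_eq_modularCharacterFun, Complex.real_smul]
        ring
    _ = ∫ s, (∫ r, h (s * r) * g r⁻¹ ∂μ) ∂μ := by
        refine integral_integral_swap_of_hasCompactSupport (by
          simp only [Function.uncurry_def]; fun_prop)
          (HasCompactSupport.intro (hgc.isCompact.inv.prod hK) ?_)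
        rintro ⟨r, s⟩ hrs
        contrapose! hrs
        have h1 := subset_tsupport h (a := s * r) (left_ne_zero_of_mul hrs)
        have h2 := subset_tsupport g (a := r⁻¹) (right_ne_zero_of_mul hrs)
        exact ⟨h2, s * r, h1, r⁻¹, h2, by simp⟩
    _ = ∫ s, (∫ r, h r * g (r⁻¹ * s) ∂μ) ∂μ := by
        congr 1 with s
        rw [← integral_mul_left_eq_self (fun r => h r * g (r⁻¹ * s)) s]
        simp
    _ = ∫ r, (∫ s, h r * g (r⁻¹ * s) ∂μ) ∂μ := by
        refine integral_integral_swap_of_hasCompactSupport (by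
          simp only [Function.uncurry_def]; fun_prop)
          (HasCompactSupport.intro (hK.prod hhc.isCompact) ?_)
        rintro ⟨s, r⟩ hrs
        contrapose! hrs
        have h1 := subset_tsupport h (a := r) (left_ne_zero_of_mul hrs)
        have h2 := subset_tsupport g (a := r⁻¹ * s) (right_ne_zero_of_mul hrs)
        exact ⟨⟨r, h1, r⁻¹ * s, h2, by simp⟩, h1⟩
    _ = (∫ y, h y ∂μ) * ∫ s, g s ∂μ := by
        rw [← integral_mul_const]
        congr 1 with r
        rw [integral_const_mul, integral_mul_left_eq_self]

/-- The two expressions for the convolution of continuous functions with compact support. -/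
theorem integral_mul_right_translate_eq_convolution {κ χ : G → ℂ} (hκ : Continuous κ)
    (hκc : HasCompactSupport κ) (hχ : Continuous χ) (x : G) :
    ∫ r, χ r * ((modularCharacterFun r : ℝ) : ℂ) * κ (x * r⁻¹) ∂μ
      = ∫ y, κ y * χ (y⁻¹ * x) ∂μ := by
  have hc : HasCompactSupport fun s => κ (x * s) := hκc.comp_homeomorph (Homeomorph.mulLeft x)
  have h := integral_eq_integral_modularCharacterFun_mul_inv (μ := μ)
    (g := fun s => κ (x * s) * χ s⁻¹) (by fun_prop) hc.mul_right
  rw [← integral_mul_left_eq_self (fun y => κ y * χ (y⁻¹ * x)) x]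
  simp only [mul_inv_rev, inv_mul_cancel_right, inv_inv] at h ⊢
  rw [h]
  congr 1 with r
  ring

/-- The functional on `L¹(G)` defined by an element of `L^∞(G)`. -/
noncomputable def boundedPairing (a : Lp ℂ ∞ μ) : Lp ℂ 1 μ →L[ℂ] ℂ :=
  (ContinuousLinearMap.mul ℂ ℂ).lpPairing μ ∞ 1 a

theorem boundedPairing_apply (a : Lp ℂ ∞ μ) (h : Lp ℂ 1 μ) :
    boundedPairing a h = ∫ x, a x * h x ∂μ :=
  (ContinuousLinearMap.mul ℂ ℂ).lpPairing_eq_integral a h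

theorem boundedPairing_conv (a : Lp ℂ ∞ μ) (k f : Lp ℂ 1 μ) :
    boundedPairing a (conv μ k f) = ∫ y, k y * boundedPairing a (leftReg 1 μ y f) ∂μ := by
  refine ((boundedPairing a).integral_comp_comm
    (integrable_smul_bcf k (leftOrbit μ f))).symm.trans ?_
  congr 1 with y
  rw [map_smul, smul_eq_mul]
  rfl

theorem coeFn_mulOp (a : Lp ℂ ∞ μ) (u : Lp ℂ 2 μ) :
    mulOp μ a u =ᵐ[μ] fun x => a x * u x :=
  (ContinuousLinearMap.mul ℂ ℂ).coeFn_holder a u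

theorem boundedPairing_conv_of_continuous (a : Lp ℂ ∞ μ) {k f : Lp ℂ 1 μ} {κ χ : G → ℂ}
    (hκ : Continuous κ) (hκc : HasCompactSupport κ) (hk : k =ᵐ[μ] κ) (hχ : Continuous χ)
    (hχc : HasCompactSupport χ) (hf : f =ᵐ[μ] χ) :
    boundedPairing a (conv μ k f) = ∫ x, a x * (∫ y, κ y * χ (y⁻¹ * x) ∂μ) ∂μ := by
  rw [boundedPairing_conv, ← integral_integral_swap_mul_of_hasCompactSupport]
  · refine integral_congr_ae ?_
    filter_upwards [hk] with y hy
    rw [hy, boundedPairing_apply, ← integral_const_mul]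
    refine integral_congr_ae ?_
    filter_upwards [coeFn_leftReg y f,
      (measurePreserving_mul_left μ y⁻¹).quasiMeasurePreserving.ae hf] with x h1 h2
    rw [h1, h2]
    ring
  · simp only [Function.uncurry_def]; fun_prop
  · refine HasCompactSupport.intro ((hκc.isCompact.mul hχc.isCompact).prod hκc.isCompact) ?_
    rintro ⟨x, y⟩ hxy
    contrapose! hxy
    have h1 := subset_tsupport κ (a := y) (left_ne_zero_of_mul hxy)
    have h2 := subset_tsupport χ (a := y⁻¹ * x) (right_ne_zero_of_mul hxy)
    exact ⟨⟨y, h1, y⁻¹ * x, h2, by simp⟩, h1⟩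

/-- The two factors `Δ(r⁻¹)^{1/2}` combine to `Δ(r⁻¹)`, and only the product `φ * star ψ` is seen by
a multiplication operator. -/
theorem vecFun_adOp_rightReg_mulOp (a : Lp ℂ ∞ μ) {u v : Lp ℂ 2 μ} {φ ψ : G → ℂ}
    (hu : u =ᵐ[μ] φ) (hv : v =ᵐ[μ] ψ) (r : G) :
    vecFun u v (adOp (rightReg μ r).toContinuousLinearMap (mulOp μ a))
      = ∫ x, a x * (((modularCharacterFun r : ℝ) : ℂ)
          * (φ (x * r⁻¹) * star (ψ (x * r⁻¹)))) ∂μ := by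
  rw [vecFun_adOp_rightReg, L2.inner_def]
  refine integral_congr_ae ?_
  filter_upwards [coeFn_mulOp a (rightReg μ r⁻¹ u), coeFn_rightReg r⁻¹ u, coeFn_rightReg r⁻¹ v,
    ae_rightTranslate r⁻¹ hu, ae_rightTranslate r⁻¹ hv] with x h1 h2 h3 h4 h5
  rw [h1, h2, h3, h4, h5, RCLike.inner_apply, modularFn_inv_eq, map_mul, Complex.conj_ofReal]
  have hs : ((Real.sqrt (modularCharacterFun r) : ℝ) : ℂ)
      * ((Real.sqrt (modularCharacterFun r) : ℝ) : ℂ) = ((modularCharacterFun r : ℝ) : ℂ) := by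
    rw [← Complex.ofReal_mul, Real.mul_self_sqrt (NNReal.coe_nonneg _)]
  rw [← hs]
  simp only [starRingEnd_apply]
  ring

/-- On multiplication operators, `θ(f)` is given by convolution. -/
theorem theta_vecFun_mulOp (a : Lp ℂ ∞ μ) (f : Lp ℂ 1 μ) {u v : Lp ℂ 2 μ} {k : Lp ℂ 1 μ}
    {φ ψ : G → ℂ} (hφ : Continuous φ) (hφc : HasCompactSupport φ) (hu : u =ᵐ[μ] φ)
    (hψ : Continuous ψ) (hv : v =ᵐ[μ] ψ) (hk : k =ᵐ[μ] fun x => φ x * star (ψ x)) :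
    theta μ f (vecFun u v) (mulOp μ a) = boundedPairing a (conv μ k f) := by
  set c : G →ᵇ ℂ := BoundedContinuousFunction.ofNormedAddCommGroup
    (fun r => thetaPt μ r (vecFun u v) (mulOp μ a))
    ((continuous_thetaPt_vecFun u v).clm_apply continuous_const)
    (‖vecFun u v‖ * ‖mulOp μ a‖) fun r => ((vecFun u v).le_opNorm _).trans (by
      gcongr; exact norm_adOp_rightReg_apply_le r _) with hc
  have hL : ∀ f, theta μ f (vecFun u v) (mulOp μ a) = integralPairing μ ℂ f c := fun f =>
    theta_apply f (vecFun_mem_predual u v) (mulOp μ a)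
  have hdense := (dense_compactlySupportedLp μ (p := 1) ENNReal.one_ne_top).closure_eq
  -- Both sides are continuous in `f`, so `f` may be taken in `C_c`, where Fubini applies.
  suffices h : closure (compactlySupportedLp μ 1) ⊆ {f | integralPairing μ ℂ f c
      = boundedPairing a (integralPairing μ _ k (leftOrbit μ f))} from
    (hL f).trans (h (hdense ▸ Set.mem_univ f))
  refine closure_minimal ?_ (isClosed_eq (by fun_prop) (by fun_prop))
  rintro f ⟨χ, hχ, hχc, hf⟩
  have hκc : HasCompactSupport fun x => φ x * star (ψ x) := hφc.mul_right
  have hκ : Continuous fun x => φ x * star (ψ x) := by fun_prop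
  rw [Set.mem_ofPred_eq, ← hL, ← conv_eq_integralPairing,
    boundedPairing_conv_of_continuous a hκ hκc hk hχ hχc hf,
    theta_apply f (vecFun_mem_predual u v) (mulOp μ a)]
  simp only [← integral_mul_right_translate_eq_convolution hκ hκc hχ]
  rw [← integral_integral_swap_mul_of_hasCompactSupport]
  · refine integral_congr_ae ?_
    filter_upwards [hf] with r hr
    rw [hr, vecFun_adOp_rightReg_mulOp a hu hv, ← integral_const_mul]
    congr 1 with x
    ring
  · have := continuous_modularCharacterFun μ
    simp only [Function.uncurry_def]; fun_prop
  · refine HasCompactSupport.intro ((hκc.isCompact.mul hχc.isCompact).prod hχc.isCompact) ?_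
    rintro ⟨x, r⟩ hxr
    contrapose! hxr
    have h1 := subset_tsupport χ (a := r) (left_ne_zero_of_mul (left_ne_zero_of_mul hxr))
    have h2 := subset_tsupport (fun x => φ x * star (ψ x)) (a := x * r⁻¹)
      (right_ne_zero_of_mul hxr)
    exact ⟨⟨x * r⁻¹, h2, r, h1, by simp⟩, h1⟩

end Group

/-! ### The annihilator of `Ran J`, its diagonal and its bimodule property. -/

section Group

variable {G : Type*} [Group G] [TopologicalSpace G] [IsTopologicalGroup G]
  [LocallyCompactSpace G] [T2Space G] [MeasurableSpace G] [BorelSpace G]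
  {μ : Measure G} [IsHaarMeasure μ] [InnerRegular μ] {J : Submodule ℂ (Lp ℂ 1 μ)}

theorem mem_ranPerp_iff {T : Lp ℂ 2 μ →L[ℂ] Lp ℂ 2 μ} :
    T ∈ ranPerp μ J ↔ ∀ f ∈ J, ∀ ω ∈ predual (Lp ℂ 2 μ), theta μ f ω T = 0 := by
  refine ⟨fun h f hf ω hω => h _ ?_, fun h => ?_⟩
  · exact Submodule.le_topologicalClosure _ (Submodule.subset_span ⟨f, hf, ω, hω, rfl⟩)
  · refine apply_eq_zero_of_mem_closure_span (A := Lp ℂ 2 μ →L[ℂ] Lp ℂ 2 μ) ?_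
    rintro _ ⟨f, hf, ω, hω, rfl⟩
    exact h f hf ω hω

/-- For `C_c` vectors the value is `⟨a, k * f⟩` with `k * f ∈ J`. Continuity in the two vectors,
then the series of vector functionals, reaches every `ω`. -/
theorem theta_mulOp_eq_zero (hJ : IsLeftIdeal μ J) {a : Lp ℂ ∞ μ} (ha : a ∈ annihilator μ J)
    {f : Lp ℂ 1 μ} (hf : f ∈ J) {ω : (Lp ℂ 2 μ →L[ℂ] Lp ℂ 2 μ) →L[ℂ] ℂ}
    (hω : ω ∈ predual (Lp ℂ 2 μ)) : theta μ f ω (mulOp μ a) = 0 := by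
  have hvec : ∀ q : Lp ℂ 2 μ × Lp ℂ 2 μ, theta μ f (vecFun q.1 q.2) (mulOp μ a) = 0 := by
    have hcont : Continuous fun q : Lp ℂ 2 μ × Lp ℂ 2 μ =>
        theta μ f (vecFun q.1 q.2) (mulOp μ a) := by
      simp only [theta_apply f (vecFun_mem_predual _ _)]
      exact continuous_integral_mul_comp (A := Lp ℂ 2 μ →L[ℂ] Lp ℂ 2 μ)
        norm_adOp_rightReg_apply_le (continuous_vecFun continuous_fst continuous_snd)
        (fun q => continuous_thetaPt_vecFun q.1 q.2) f (mulOp μ a)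
    have hd := dense_compactlySupportedLp μ (p := 2) ENNReal.ofNat_ne_top
    have hdense := (hd.prod hd).closure_eq
    intro q
    suffices h : closure (compactlySupportedLp μ 2 ×ˢ compactlySupportedLp μ 2)
        ⊆ {q | theta μ f (vecFun q.1 q.2) (mulOp μ a) = 0} from h (hdense ▸ Set.mem_univ q)
    refine closure_minimal ?_ (isClosed_eq hcont continuous_const)
    rintro ⟨u, v⟩ ⟨⟨φ, hφ, hφc, hu⟩, ⟨ψ, hψ, hψc, hv⟩⟩
    have hm : MemLp (fun x => φ x * star (ψ x)) 1 μ :=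
      Continuous.memLp_of_hasCompactSupport (by fun_prop) hφc.mul_right
    exact (theta_vecFun_mulOp a f hφ hφc hu hψ hv hm.coeFn_toLp).trans
      ((boundedPairing_apply _ _).trans (ha _ (hJ _ f hf)))
  obtain ⟨u, v, hu, hv, h⟩ := exists_hasSum_vecFun hω
  refine (hasSum_theta_apply hu hv hω h f (mulOp μ a)).unique ?_
  simp only [hvec (_, _)]
  exact hasSum_zero

/-- A single bump function replaces an approximate identity: if the continuous function `Λ` were
nonzero at `1`, its integral against a suitable `|φ|²` near `1` could not vanish. -/
theorem mem_annihilator_of_mulOp_mem_ranPerp {a : Lp ℂ ∞ μ} (h : mulOp μ a ∈ ranPerp μ J) :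
    a ∈ annihilator μ J := by
  intro f hf
  rw [← boundedPairing_apply]
  by_contra hne
  set Λ : G → ℂ := fun y => boundedPairing a (leftReg 1 μ y f) with hΛ
  have hΛc : Continuous Λ := (boundedPairing a).continuous.comp (continuous_leftReg f)
  have hΛ1 : Λ 1 = boundedPairing a f := by
    simp only [hΛ]
    congr 1
    refine Lp.ext ?_
    filter_upwards [coeFn_leftReg 1 f] with t ht
    rw [ht]; simp
  set R : G → ℝ := fun y => (star (Λ 1) * Λ y).re with hR
  have hRc : Continuous R := by fun_prop
  have hR1 : 0 < R 1 := by
    have : star (Λ 1) * Λ 1 = ((‖Λ 1‖ ^ 2 : ℝ) : ℂ) := by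
      rw [mul_comm, Complex.star_def, Complex.mul_conj, Complex.normSq_eq_norm_sq]
    simp only [hR, this, Complex.ofReal_re]
    have : Λ 1 ≠ 0 := by rwa [hΛ1]
    positivity
  -- `g` is killed on `{R ≤ 0}`, so `g ^ 2 * R` is nonnegative everywhere and positive at `1`.
  obtain ⟨g, hg1, hg0, hgc, hg01⟩ := exists_continuous_one_zero_of_isCompact
    (isCompact_singleton (x := (1 : G))) (isClosed_le hRc continuous_const)
    (Set.disjoint_singleton_left.2 (by simpa using hR1))
  let φ : G → ℂ := fun y => (g y : ℂ)
  have hφ : Continuous φ := by fun_prop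
  have hφc : HasCompactSupport φ := hgc.comp_left (g := fun y : ℝ => (y : ℂ)) (by simp)
  have hu : MemLp φ 2 μ := hφ.memLp_of_hasCompactSupport hφc
  have hm : MemLp (fun x => φ x * star (φ x)) 1 μ :=
    Continuous.memLp_of_hasCompactSupport (by fun_prop) hφc.mul_right
  have h1 : ∫ y, (φ y * star (φ y)) * Λ y ∂μ = 0 := by
    rw [← mem_ranPerp_iff.1 h f hf _ (vecFun_mem_predual (hu.toLp φ) (hu.toLp φ)),
      theta_vecFun_mulOp a f hφ hφc hu.coeFn_toLp hφ hu.coeFn_toLp hm.coeFn_toLp,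
      boundedPairing_conv]
    refine integral_congr_ae ?_
    filter_upwards [hm.coeFn_toLp] with y hy
    rw [hy]
  have hint : Integrable (fun y => star (Λ 1) * ((φ y * star (φ y)) * Λ y)) μ :=
    Continuous.integrable_of_hasCompactSupport (by fun_prop)
      (HasCompactSupport.mul_left (hφc.mul_right.mul_right))
  have h2 : ∫ y, g y ^ 2 * R y ∂μ = 0 := by
    have h3 : ∫ y, star (Λ 1) * ((φ y * star (φ y)) * Λ y) ∂μ = 0 := by
      rw [integral_const_mul, h1, mul_zero]
    have h4 := integral_re hint
    rw [h3] at h4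
    rw [← show RCLike.re (0 : ℂ) = (0 : ℝ) from by simp, ← h4]
    congr 1 with y
    simp only [φ, hR, Complex.star_def, Complex.conj_ofReal]
    rw [show (starRingEnd ℂ) (Λ 1) * ((g y : ℂ) * (g y : ℂ) * Λ y)
      = ((g y ^ 2 : ℝ) : ℂ) * ((starRingEnd ℂ) (Λ 1) * Λ y) by push_cast; ring]
    exact (Complex.re_ofReal_mul _ _).symm
  have h5 : 0 < ∫ y, g y ^ 2 * R y ∂μ := by
    refine Continuous.integral_pos_of_hasCompactSupport_nonneg_nonzero (x := 1) (by fun_prop)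
      ((hgc.comp_left (g := fun t : ℝ => t ^ 2) (by simp)).mul_right) (fun y => ?_) ?_
    · by_cases hy : R y ≤ 0
      · simp [hg0 hy]
      · exact mul_nonneg (sq_nonneg _) (not_le.1 hy).le
    · rw [hg1 rfl]
      simpa using hR1.ne'
  exact h5.ne' h2

theorem adOp_leftReg_mul_mul (r s t : G) (T : Lp ℂ 2 μ →L[ℂ] Lp ℂ 2 μ) :
    adOp (rightReg μ r).toContinuousLinearMap (leftReg 2 μ s * T * leftReg 2 μ t)
      = leftReg 2 μ s * adOp (rightReg μ r).toContinuousLinearMap T * leftReg 2 μ t := by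
  ext1 u
  change rightReg μ r (leftReg 2 μ s (T (leftReg 2 μ t (ContinuousLinearMap.adjoint
    (rightReg μ r).toContinuousLinearMap u)))) = leftReg 2 μ s (rightReg μ r (T
      (ContinuousLinearMap.adjoint (rightReg μ r).toContinuousLinearMap (leftReg 2 μ t u))))
  rw [adjoint_rightReg, LinearIsometry.coe_toContinuousLinearMap, leftReg_rightReg,
    leftReg_rightReg]

/-- Translations commute with `Ad ρ_r`, so `λ_s M_a λ_t` is handled by moving `λ_s` and `λ_t` into
`ω`. Multiplication is separately weak-* continuous, so `λ_t` is replaced by `B` first and `λ_s` by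
`A` afterwards. -/
theorem bim_subset_ranPerp (hJ : IsLeftIdeal μ J) :
    bim μ (annihilator μ J) ⊆ ranPerp μ J := by
  refine fun T hT => mem_ranPerp_iff.2 fun f hf ω hω => ?_
  have hθ := theta_mem_predual f hω
  refine eq_zero_of_mem_weakStarSpan hθ ?_ hT
  rintro _ ⟨A, hA, B, hB, a, ha, rfl⟩
  have hst : ∀ s t : G, theta μ f ω (leftReg 2 μ s * mulOp μ a * leftReg 2 μ t) = 0 := by
    intro s t
    obtain ⟨ω', hω', h⟩ := exists_mem_predual_mul_mul hω (leftReg 2 μ s) (leftReg 2 μ t)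
    rw [← theta_mulOp_eq_zero hJ ha hf hω', theta_apply f hω, theta_apply f hω']
    simp only [h, adOp_leftReg_mul_mul]
  have hsB : ∀ s : G, theta μ f ω (leftReg 2 μ s * mulOp μ a * B) = 0 := by
    intro s
    obtain ⟨ω', hω', h⟩ := exists_mem_predual_mul_mul hθ (leftReg 2 μ s * mulOp μ a) 1
    simp only [mul_one] at h
    rw [← h]
    refine eq_zero_of_mem_weakStarSpan hω' ?_ hB
    rintro _ ⟨t, rfl⟩
    rw [h, hst]
  obtain ⟨ω', hω', h⟩ := exists_mem_predual_mul_mul hθ 1 (mulOp μ a * B)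
  simp only [one_mul, ← mul_assoc] at h
  rw [← h]
  refine eq_zero_of_mem_weakStarSpan hω' ?_ hA
  rintro _ ⟨s, rfl⟩
  rw [h, hsB]

theorem mulOp_mem_bim {U : Set (Lp ℂ ∞ μ)} {a : Lp ℂ ∞ μ} (ha : a ∈ U) :
    mulOp μ a ∈ bim μ U := by
  have h1 : (1 : Lp ℂ 2 μ →L[ℂ] Lp ℂ 2 μ) ∈ groupVN μ :=
    subset_weakStarSpan _ ⟨1, leftReg_one⟩
  exact subset_weakStarSpan _ ⟨1, h1, 1, h1, a, ha, by rw [one_mul, mul_one]⟩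

end Group

end HarmonicBimodule

open HarmonicBimodule in
theorem mainTheorem9 {G : Type*} [Group G] [TopologicalSpace G] [IsTopologicalGroup G]
    [LocallyCompactSpace G] [T2Space G] [MeasurableSpace G] [BorelSpace G]
    (μ : MeasureTheory.Measure G) [μ.IsHaarMeasure] [μ.InnerRegular]
    (J : Submodule ℂ (MeasureTheory.Lp ℂ 1 μ)) (hJ : IsLeftIdeal μ J) :
    bim μ (annihilator μ J) ⊆ ranPerp μ J ∧
    bim μ (annihilator μ J) ∩ multMasa μ = mulOp μ '' annihilator μ J ∧
    ranPerp μ J ∩ multMasa μ = mulOp μ '' annihilator μ J := by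
  have hran : ranPerp μ J ∩ multMasa μ ⊆ mulOp μ '' annihilator μ J := by
    rintro _ ⟨hT, a, rfl⟩
    exact ⟨a, mem_annihilator_of_mulOp_mem_ranPerp hT, rfl⟩
  have hbim : mulOp μ '' annihilator μ J ⊆ bim μ (annihilator μ J) ∩ multMasa μ := by
    rintro _ ⟨a, ha, rfl⟩
    exact ⟨mulOp_mem_bim ha, a, rfl⟩
  have hsub := bim_subset_ranPerp hJ
  have hinter := Set.inter_subset_inter_left (multMasa μ) hsub
  -- The inclusions `hbim`, `hinter` and `hran` form a cycle, so all three sets agree.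
  exact ⟨hsub, (hinter.trans hran).antisymm hbim, hran.antisymm (hbim.trans hinter)⟩
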